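/- Let $n\ge 7$ be an integer. Define the Joseph–Lundgren exponent $$p_c(n)=\begin{cases}\infty & n\le 14,\\[2pt] \dfrac{n+4-2d(n)}{n-8-2d(n)} & n\ge 15,\end{cases}\qquad d(n)=\frac16\Big(9n^2+96-\frac{1536+1152n^2}{d_0(n)}-\frac32 d_0(n)\Big)^{1/2},$$ where $d_0(n)=-\big(d_1(n)+36\sqrt{d_2(n)}\big)^{1/3}$ (real cube root) and $$d_1(n)=-94976+20736n+103104n^2-10368n^3-3024n^4+1296n^5-108n^6,$$ $$\begin{aligned}d_2(n)={}&6131712-3039232n-16644096n^2+4818944n^3+6915840n^4-1936384n^5-690432n^6\\&+251136n^7-30864n^8-4320n^9+1800n^{10}-216n^{11}+9n^{12}.\end{aligned}$$ **Theorem 4.1.** Let $p\in\mathbb{R}$ satisfy $\frac{n+6}{n-6}<p<p_c(n)$. Let $u\in W^{3,2}_{loc}(\mathbb{R}^n\setminus\{0\})$ be real-valued with $|u|^{p+1}\in L^1_{loc}(\mathbb{R}^n\setminus\{0\})$, and suppose that 1. $u$ is homogeneous: there is a function $w$ on the unit sphere $S^{n-1}$ with $u(x)=|x|^{-6/(p-1)}\,w(x/|x|)$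 for almost every $x$; 2. $u$ is a weak solution of $(-\Delta)^3u=|u|^{p-1}u$ in $\mathbb{R}^n\setminus\{0\}$, that is, $$\int_{\mathbb{R}^n}\nabla\Delta u\cdot\nabla\Delta\varphi\,dx=\int_{\mathbb{R}^n}|u|^{p-1}u\,\varphi\,dx\qquad\text{for all }\varphi\in C_c^\infty(\mathbb{R}^n\setminus\{0\});$$ 3. $u$ is stable, that is, $$p\int_{\mathbb{R}^n}|u|^{p-1}\varphi^2\,dx\le\int_{\mathbb{R}^n}|\nabla\Delta\varphi|^2\,dx\qquad\text{for all }\varphi\in C_c^\infty(\mathbb{R}^n\setminus\{0\}).$$ Then $u=0$ almost everywhere in $\mathbb{R}^n$. -/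

import Mathlib

open MeasureTheory
open scoped ContDiff Laplacian RealInnerProductSpace

noncomputable section

namespace Triharmonic

/-- `ℝⁿ` with its Euclidean norm and Lebesgue measure. -/
abbrev E (n : ℕ) : Type := EuclideanSpace ℝ (Fin n)

/-! ### Function spaces -/

/-- `φ ∈ C_c^∞(Ω)`. -/
def IsTestFunction {n : ℕ} (Ω : Set (E n)) (φ : E n → ℝ) : Prop :=
  ContDiff ℝ ∞ φ ∧ HasCompactSupport φ ∧ tsupport φ ⊆ Ω

/-- `f ∈ L²_loc(Ω)`: `f` is square integrable on every compact subset of `Ω`. -/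
def MemL2Loc {n : ℕ} {F : Type*} [NormedAddCommGroup F] (Ω : Set (E n)) (f : E n → F) : Prop :=
  ∀ K : Set (E n), IsCompact K → K ⊆ Ω → MemLp f 2 (volume.restrict K)

/-- `v` is the weak partial derivative `∂ᵢ u` on `Ω`. -/
def IsWeakPartial {n : ℕ} (Ω : Set (E n)) (i : Fin n) (u v : E n → ℝ) : Prop :=
  ∀ φ : E n → ℝ, IsTestFunction Ω φ →
    ∫ x, u x * fderiv ℝ φ x (EuclideanSpace.single i 1) = - ∫ x, v x * φ x

/-- `u ∈ W^{m,2}_loc(Ω)`: `u ∈ L²_loc(Ω)` and all weak derivatives of `u` of order at most `m`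
exist and lie in `L²_loc(Ω)`. -/
def MemW2Loc {n : ℕ} (Ω : Set (E n)) : ℕ → (E n → ℝ) → Prop
  | 0, u => MemL2Loc Ω u
  | m + 1, u => MemL2Loc Ω u ∧ ∀ i : Fin n, ∃ v : E n → ℝ, IsWeakPartial Ω i u v ∧ MemW2Loc Ω m v

/-! ### The equation and stability -/

/-- `G ∈ L²_loc(Ω; ℝⁿ)` is the weak derivative `∇Δu` on `Ω`; it is unique up to null sets. -/
def IsWeakGradLaplacian {n : ℕ} (Ω : Set (E n)) (u : E n → ℝ) (G : E n → E n) : Prop :=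
  MemL2Loc Ω G ∧ ∀ φ : E n → ℝ, IsTestFunction Ω φ →
    ∫ x, φ x • G x = - ∫ x, u x • gradient (Δ φ) x

/-- `u` is a weak solution of `(-Δ)³ u = |u|^{p-1} u` on `Ω`:
`∫ ∇Δu · ∇Δφ = ∫ |u|^{p-1} u φ` for all `φ ∈ C_c^∞(Ω)`. -/
def IsWeakSolution {n : ℕ} (Ω : Set (E n)) (p : ℝ) (u : E n → ℝ) : Prop :=
  ∃ G : E n → E n, IsWeakGradLaplacian Ω u G ∧
    ∀ φ : E n → ℝ, IsTestFunction Ω φ →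
      ∫ x, ⟪G x, gradient (Δ φ) x⟫ = ∫ x, |u x| ^ (p - 1) * u x * φ x

/-- `u` is stable on `Ω`: `p ∫ |u|^{p-1} φ² ≤ ∫ |∇Δφ|²` for all `φ ∈ C_c^∞(Ω)`. -/
def IsStable {n : ℕ} (Ω : Set (E n)) (p : ℝ) (u : E n → ℝ) : Prop :=
  ∀ φ : E n → ℝ, IsTestFunction Ω φ →
    p * ∫ x, |u x| ^ (p - 1) * φ x ^ 2 ≤ ∫ x, ‖gradient (Δ φ) x‖ ^ 2

/-! ### The Joseph-Lundgren exponent -/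

/-- The real cube root, also of negative numbers. -/
def realCbrt (y : ℝ) : ℝ := if 0 ≤ y then y ^ (1 / 3 : ℝ) else -((-y) ^ (1 / 3 : ℝ))

def d₁ (n : ℝ) : ℝ :=
  -94976 + 20736 * n + 103104 * n ^ 2 - 10368 * n ^ 3 + 1296 * n ^ 5 - 3024 * n ^ 4 - 108 * n ^ 6

def d₂ (n : ℝ) : ℝ :=
  6131712 - 16644096 * n ^ 2 + 6915840 * n ^ 4 - 690432 * n ^ 6 - 3039232 * n
    + 4818944 * n ^ 3 - 1936384 * n ^ 5 + 251136 * n ^ 7 - 30864 * n ^ 8 - 4320 * n ^ 9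
    + 1800 * n ^ 10 - 216 * n ^ 11 + 9 * n ^ 12

def d₀ (n : ℝ) : ℝ := - realCbrt (d₁ n + 36 * √(d₂ n))

def d (n : ℝ) : ℝ :=
  1 / 6 * √(9 * n ^ 2 + 96 - (1536 + 1152 * n ^ 2) / d₀ n - 3 / 2 * d₀ n)

/-- The exponent `p_c(n) ∈ (1, ∞]`. -/
def josephLundgrenExponent (n : ℕ) : EReal :=
  if n ≤ 14 then ⊤ else (((n + 4 - 2 * d n) / (n - 8 - 2 * d n) : ℝ) : EReal)

end Triharmonic

end

/-!
Write `k = 6 / (p - 1)` and `u = r ^ (-k) w(θ)`. Then `(-Δ)³ u = |u|^{p-1} u` becomes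
`A(-Δ_S) w = |w|^{p-1} w` on the sphere, weakly, for an explicit cubic `A`. Testing stability with
`r ^ (3 - n / 2) η(log r) q(θ)`, where `η` is stretched until its derivatives are negligible, leaves
`p ∫ |w|^{p-1} q² ≤ ⟨q, B(-Δ_S) q⟩` for a second cubic `B`. Below the Joseph–Lundgren exponent there
is `κ < 1` with `B ≤ κ p A` coefficient by coefficient: for the constant terms this is the sign of a
cubic whose smallest root Cardano's formula identifies as `d(n)²`, and it implies the others. With
`q = w` it would follow that `∫ |w|^{p+1} ≤ κ ∫ |w|^{p+1}`, so `w = 0`.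

Since `w` is not known to be smooth, `q` runs instead through the `L²` projections `ψₘ` of `w` to
the polynomials of degree at most `m`. These spaces are invariant under `-Δ_S`, so
`∫ |w|^{p-1} w ψₘ = ⟨ψₘ, A(-Δ_S) ψₘ⟩`. This controls `∫ |w|^{p-1} ψₘ²` by
`κ ∫ |w|^{p-1} w ψₘ`, hence, as `2 w ψₘ ≤ w² + ψₘ²`, by `κ / (2 - κ) ∫ |w|^{p+1}`, and Fatou's lemma
along a subsequence with `ψₘ → w` almost everywhere gives `∫ |w|^{p+1} ≤ κ / (2 - κ) ∫ |w|^{p+1}`.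
-/

open Polynomial

noncomputable section

namespace Triharmonic

/-! ### The Joseph–Lundgren exponent -/

/-- The cubic in `S` whose smallest root, for `ν ≥ 15`, is `d ν ^ 2`. For `S = (ν / 2 - 4 - k) ^ 2`
it compares the constant terms of the symbols of `(-Δ)³` at the homogeneity `-k` and at the Hardy
exponent, see `angularSymbol`. -/
def josephLundgrenCubic (ν S : ℝ) : ℝ :=
  ((ν / 2) ^ 2 - S) * ((ν / 2 + 2) ^ 2 - S) * ((ν / 2 - 2) ^ 2 - S)
    - ((ν / 2 - 3) * (ν / 2 - 1) * (ν / 2 + 1)) ^ 2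

theorem depressed_cubic_neg_iff {α β y : ℝ} (h : α + β < 0) :
    y ^ 3 - 3 * (α * β) * y - (α ^ 3 + β ^ 3) < 0 ↔ y < α + β := by
  have hfactor : y ^ 3 - 3 * (α * β) * y - (α ^ 3 + β ^ 3)
      = (y - (α + β)) * ((y + (α + β) / 2) ^ 2 + 3 / 4 * (α - β) ^ 2) := by ring
  rw [hfactor, ← sub_neg (b := α + β)]
  constructor
  · exact fun hneg => neg_of_mul_neg_left hneg (by positivity)
  · intro hy
    have : y + (α + β) / 2 ≠ 0 := by linarith
    exact mul_neg_of_neg_of_pos hy (by positivity)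

theorem josephLundgrenCubic_eq_depressed (ν S : ℝ) :
    josephLundgrenCubic ν S
      = -((36 * S - 9 * ν ^ 2 - 96) ^ 3
          - 9 / 2 * (1536 + 1152 * ν ^ 2) * (36 * S - 9 * ν ^ 2 - 96)
          - 27 / 4 * d₁ ν) / 36 ^ 3 := by
  unfold josephLundgrenCubic d₁; ring

theorem d₁_sq_sub (ν : ℝ) : d₁ ν ^ 2 - 1296 * d₂ ν = 8 / 27 * (1536 + 1152 * ν ^ 2) ^ 3 := by
  unfold d₁ d₂; ring

theorem d₁_neg {ν : ℝ} (h : 15 ≤ ν) : d₁ ν < 0 := by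
  obtain ⟨m, hm, rfl⟩ : ∃ m : ℝ, 0 ≤ m ∧ ν = m + 15 := ⟨ν - 15, by linarith, by ring⟩
  have : d₁ (m + 15) = -(410705036 + 208733544 * m + 42718356 * m ^ 2 + 4565808 * m ^ 3
      + 270324 * m ^ 4 + 8424 * m ^ 5 + 108 * m ^ 6) := by unfold d₁; ring
  rw [this, neg_lt_zero]
  positivity

theorem d₂_nonneg {ν : ℝ} (h : 15 ≤ ν) : 0 ≤ d₂ ν := by
  obtain ⟨m, hm, rfl⟩ : ∃ m : ℝ, 0 ≤ m ∧ ν = m + 15 := ⟨ν - 15, by linarith, by ring⟩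
  have : d₂ (m + 15) = 126100750123257 + 130684714202588 * m + 60426347513634 * m ^ 2
      + 16630573432844 * m ^ 3 + 3048957353415 * m ^ 4 + 393377921336 * m ^ 5
      + 36687653148 * m ^ 6 + 2494830456 * m ^ 7 + 122860311 * m ^ 8 + 4275180 * m ^ 9
      + 99810 * m ^ 10 + 1404 * m ^ 11 + 9 * m ^ 12 := by unfold d₂; ring
  rw [this]
  positivity

theorem d₁_add_sqrt_d₂_neg {ν : ℝ} (h : 15 ≤ ν) : d₁ ν + 36 * √(d₂ ν) < 0 := by
  have hpos : 0 < 8 / 27 * (1536 + 1152 * ν ^ 2) ^ 3 := by positivity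
  nlinarith [d₁_neg h, Real.sq_sqrt (d₂_nonneg h), d₁_sq_sub ν, Real.sqrt_nonneg (d₂ ν)]

theorem d₀_eq {ν : ℝ} (h : 15 ≤ ν) : d₀ ν = (-(d₁ ν + 36 * √(d₂ ν))) ^ (1 / 3 : ℝ) := by
  simp [d₀, realCbrt, not_le.mpr (d₁_add_sqrt_d₂_neg h)]

theorem d₀_pos {ν : ℝ} (h : 15 ≤ ν) : 0 < d₀ ν :=
  d₀_eq h ▸ Real.rpow_pos_of_pos (neg_pos.mpr (d₁_add_sqrt_d₂_neg h)) _

theorem d₀_cube {ν : ℝ} (h : 15 ≤ ν) : d₀ ν ^ 3 = -(d₁ ν + 36 * √(d₂ ν)) := by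
  rw [d₀_eq h, ← Real.rpow_natCast, ← Real.rpow_mul (neg_pos.mpr (d₁_add_sqrt_d₂_neg h)).le]
  norm_num

theorem cardano_cubes {ν : ℝ} (h : 15 ≤ ν) :
    (-((1536 + 1152 * ν ^ 2) / d₀ ν)) ^ 3 + (-(3 / 2 * d₀ ν)) ^ 3 = 27 / 4 * d₁ ν := by
  have hcube := d₀_cube h
  have hconj : (-((1536 + 1152 * ν ^ 2) / d₀ ν)) ^ 3 = 27 / 8 * (d₁ ν - 36 * √(d₂ ν)) := by
    rw [neg_pow, div_pow, hcube]
    have := (d₁_add_sqrt_d₂_neg h).ne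
    field_simp
    nlinarith [Real.sq_sqrt (d₂_nonneg h), d₁_sq_sub ν]
  rw [hconj, neg_pow, mul_pow, hcube]
  ring

/-- Cardano's formula: `36 d² - 9 ν² - 96` is the sum of the two cube roots in `cardano_cubes`. -/
theorem josephLundgrenCubic_pos_iff_lt_cardano {ν S : ℝ} (h : 15 ≤ ν) :
    0 < josephLundgrenCubic ν S ↔
      36 * S < 9 * ν ^ 2 + 96 - (1536 + 1152 * ν ^ 2) / d₀ ν - 3 / 2 * d₀ ν := by
  have hd₀ := d₀_pos h
  set α := -((1536 + 1152 * ν ^ 2) / d₀ ν) with hα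
  set β := -(3 / 2 * d₀ ν) with hβ
  have hsum : α + β < 0 := by
    have : 0 < (1536 + 1152 * ν ^ 2) / d₀ ν := by positivity
    linarith
  have hprod : 9 / 2 * (1536 + 1152 * ν ^ 2) = 3 * (α * β) := by rw [hα, hβ]; field_simp; ring
  rw [josephLundgrenCubic_eq_depressed, hprod, ← cardano_cubes h, div_pos_iff_of_pos_right
    (by norm_num), neg_pos, depressed_cubic_neg_iff hsum]
  constructor <;> intro hlt <;> linarith

theorem josephLundgrenCubic_one_pos {ν : ℝ} (h : 6 < ν) : 0 < josephLundgrenCubic ν 1 := by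
  have : josephLundgrenCubic ν 1 = 6 * ((ν / 2 - 1) * (ν / 2 + 1)) ^ 2 * (ν / 2 - 3) := by
    unfold josephLundgrenCubic; ring
  have : 0 < ν / 2 - 3 := by linarith
  have : 0 < ν / 2 - 1 := by linarith
  have : 0 < ν / 2 + 1 := by linarith
  rw [‹josephLundgrenCubic ν 1 = _›]
  positivity

theorem josephLundgrenCubic_anti {ν S T : ℝ} (hν : 0 ≤ ν) (hST : S ≤ T)
    (hT : T ≤ (ν / 2 - 2) ^ 2) (hT' : T ≤ (ν / 2) ^ 2) :
    josephLundgrenCubic ν T ≤ josephLundgrenCubic ν S := by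
  have : 0 ≤ (ν / 2) ^ 2 - T := by linarith
  have : 0 ≤ (ν / 2 + 2) ^ 2 - T := by nlinarith
  have : 0 ≤ (ν / 2 - 2) ^ 2 - T := by linarith
  have : 0 ≤ (ν / 2) ^ 2 - S := by linarith
  have : 0 ≤ (ν / 2 + 2) ^ 2 - S := by linarith
  unfold josephLundgrenCubic
  gcongr

theorem sq_d {ν : ℝ} (h : 15 ≤ ν) :
    36 * d ν ^ 2 = 9 * ν ^ 2 + 96 - (1536 + 1152 * ν ^ 2) / d₀ ν - 3 / 2 * d₀ ν := by
  have hone := (josephLundgrenCubic_pos_iff_lt_cardano h).mp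
    (josephLundgrenCubic_one_pos (by linarith))
  rw [d, mul_pow, Real.sq_sqrt (by linarith)]
  ring

theorem josephLundgrenCubic_pos_iff {ν S : ℝ} (h : 15 ≤ ν) :
    0 < josephLundgrenCubic ν S ↔ S < d ν ^ 2 := by
  rw [josephLundgrenCubic_pos_iff_lt_cardano h, ← sq_d h]
  exact mul_lt_mul_iff_right₀ (by norm_num)

theorem one_lt_d {ν : ℝ} (h : 15 ≤ ν) : 1 < d ν := by
  have hone := (josephLundgrenCubic_pos_iff h).mp (josephLundgrenCubic_one_pos (by linarith))
  exact (one_lt_sq_iff₀ (by unfold d; positivity)).mp hone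

theorem sub_div_lt_d {n : ℕ} (hn : 15 ≤ n) {p : ℝ} (hp : 1 < p)
    (hpc : (p : EReal) < josephLundgrenExponent n) : (n : ℝ) / 2 - 4 - 6 / (p - 1) < d n := by
  have hpc' : p < (n + 4 - 2 * d n) / (n - 8 - 2 * d n) := by
    rw [josephLundgrenExponent, if_neg (by omega)] at hpc
    exact_mod_cast hpc
  have hpos : 0 < 6 / (p - 1) := div_pos (by norm_num) (by linarith)
  rcases le_or_gt ((n : ℝ) - 8 - 2 * d n) 0 with hle | hgt
  · linarith
  · rw [lt_div_iff₀ hgt] at hpc'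
    have : (n : ℝ) / 2 - 4 - d n < 6 / (p - 1) := by
      rw [lt_div_iff₀ (by linarith)]
      linarith
    linarith

theorem one_lt_and_div_lt {ν p : ℝ} (hν : 6 < ν) (hp : (ν + 6) / (ν - 6) < p) :
    1 < p ∧ 6 / (p - 1) < ν / 2 - 3 := by
  have hp1 : 1 < p := lt_trans (by rw [lt_div_iff₀] <;> linarith) hp
  rw [div_lt_iff₀ (by linarith)] at hp
  exact ⟨hp1, by rw [div_lt_iff₀ (by linarith)]; nlinarith⟩

theorem josephLundgrenCubic_pos_of_lt_exponent {n : ℕ} (hn : 7 ≤ n) {p : ℝ}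
    (hp : ((n : ℝ) + 6) / ((n : ℝ) - 6) < p) (hpc : (p : EReal) < josephLundgrenExponent n) :
    0 < josephLundgrenCubic n ((n / 2 - 4 - 6 / (p - 1)) ^ 2) := by
  have hn' : (7 : ℝ) ≤ n := by exact_mod_cast hn
  obtain ⟨hp1, hk1⟩ := one_lt_and_div_lt (by linarith) hp
  have hk0 : 0 < 6 / (p - 1) := div_pos (by norm_num) (by linarith)
  rcases le_or_gt n 10 with h10 | h10
  · have : (n : ℝ) ≤ 10 := by exact_mod_cast h10
    refine (josephLundgrenCubic_one_pos (by linarith)).trans_le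
      (josephLundgrenCubic_anti (by linarith) ?_ ?_ ?_) <;> nlinarith
  have h11 : (11 : ℝ) ≤ n := by exact_mod_cast h10
  rcases le_or_gt n 14 with h14 | h14
  · have hmono := josephLundgrenCubic_anti (ν := n) (T := ((n : ℝ) / 2 - 4) ^ 2)
      (S := ((n : ℝ) / 2 - 4 - 6 / (p - 1)) ^ 2) (by linarith)
      (by nlinarith) (by nlinarith) (by nlinarith)
    refine lt_of_lt_of_le ?_ hmono
    interval_cases n <;> norm_num [josephLundgrenCubic]
  · have hn15 : (15 : ℝ) ≤ n := by exact_mod_cast h14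
    have hd := sub_div_lt_d (by omega) hp1 hpc
    exact (josephLundgrenCubic_pos_iff hn15).mpr (by nlinarith [one_lt_d hn15])

/-- The symbol of `(-Δ)³` on functions which are homogeneous of degree `-k` in dimension `ν`: the
polynomial in `X = -Δ_{S^{ν-1}}` by which it acts on the angular part. -/
def angularSymbol (ν k : ℝ) : ℝ[X] :=
  (C (k * (ν - 2 - k)) + X) * (C ((k + 2) * (ν - 4 - k)) + X) * (C ((k + 4) * (ν - 6 - k)) + X)

theorem angularSymbol_eq_toPoly {ν k a b c : ℝ} (ha : k * (ν - 2 - k) = a)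
    (hb : (k + 2) * (ν - 4 - k) = b) (hc : (k + 4) * (ν - 6 - k) = c) :
    angularSymbol ν k = Cubic.toPoly ⟨1, a + b + c, a * b + b * c + a * c, a * b * c⟩ := by
  simp only [angularSymbol, ha, hb, hc, Cubic.toPoly, map_add, map_mul, map_one]
  ring

theorem esymm_two_mul_le {X Z t : ℝ} (ht : 0 ≤ t) (hZ : 4 * t < Z) (hZX : Z ≤ X) :
    (X * (X + 4) + (X + 4) * X + X * X) * ((Z - 4 * t) * (Z + 4) * (Z + 4 * t))
      ≤ ((Z - 4 * t) * (Z + 4) + (Z + 4) * (Z + 4 * t) + (Z - 4 * t) * (Z + 4 * t))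
        * (X * (X + 4) * X) := by
  obtain ⟨P, hP⟩ : ∃ P, P = (Z - 4 * t) * (Z + 4 * t) := ⟨_, rfl⟩
  have hZ0 : 0 < Z := by linarith
  have hX0 : 0 < X := by linarith
  have hP0 : 0 ≤ P := hP ▸ mul_nonneg (by linarith) (by linarith)
  have hPZ : P ≤ Z * X := by nlinarith
  calc _ = 2 * (X * (X + 4)) * (Z + 4) * P + (X * X) * (P * (Z + 4)) := by rw [hP]; ring
    _ ≤ 2 * (X * (X + 4)) * (Z + 4) * (Z * X) + (X * X) * (P * (X + 4)) := by gcongr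
    _ = _ := by rw [hP]; ring

theorem esymm_one_mul_le {X Z t : ℝ} (ht : 0 ≤ t) (hZ : 4 * t < Z) (hZX : Z ≤ X) :
    (X + (X + 4) + X)
        * ((Z - 4 * t) * (Z + 4) + (Z + 4) * (Z + 4 * t) + (Z - 4 * t) * (Z + 4 * t))
      ≤ ((Z - 4 * t) + (Z + 4) + (Z + 4 * t)) * (X * (X + 4) + (X + 4) * X + X * X) := by
  have hZ0 : 0 < Z := by linarith
  have hX0 : 0 < X := by linarith
  have : 0 ≤ X - Z := by linarith
  have h : 0 ≤ 9 * (X * Z) * (X - Z) + 12 * ((X - Z) * (X + Z)) + 32 * (X - Z)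
      + 16 * t ^ 2 * (3 * X + 4) := by positivity
  linear_combination h

theorem lt_mul_of_mul_le_mul {a b c e p : ℝ} (hp : 0 < p) (ha : 0 < a) (hc : 0 < c)
    (hce : c < p * e) (h : a * e ≤ b * c) : a < p * b := by
  refine lt_of_mul_lt_mul_right (a := c) ?_ hc.le
  calc a * c < a * (p * e) := by gcongr
    _ = p * (a * e) := by ring
    _ ≤ p * (b * c) := by gcongr
    _ = p * b * c := by ring

/-- The inequality between the constant terms is the one on the Joseph–Lundgren cubic, and it
implies those between the other coefficients. -/
theorem coeff_angularSymbol_lt {ν k p : ℝ} (hk : 0 < k) (hkν : k < ν / 2 - 3)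
    (hpk : p * k = k + 6) (hcub : 0 < josephLundgrenCubic ν ((ν / 2 - 4 - k) ^ 2)) (i : Fin 4) :
    (angularSymbol ν (ν / 2 - 3)).coeff i < p * (angularSymbol ν k).coeff i := by
  have hp : 1 < p := lt_of_mul_lt_mul_right (by linarith) hk.le
  obtain ⟨t, ht⟩ : ∃ t, t = ν / 2 - 3 - k := ⟨_, rfl⟩
  obtain ⟨X, hX⟩ : ∃ X, X = (ν / 2 - 3) * (ν / 2 + 1) := ⟨_, rfl⟩
  obtain ⟨Z, hZ⟩ : ∃ Z, Z = X - t ^ 2 := ⟨_, rfl⟩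
  have ht0 : 0 < t := by linarith
  have hX0 : 0 < X := hX ▸ mul_pos (by linarith) (by linarith)
  have hc₁ : k * (ν - 2 - k) = Z - 4 * t := by rw [hZ, ht, hX]; ring
  have hc₂ : (k + 2) * (ν - 4 - k) = Z + 4 := by rw [hZ, ht, hX]; ring
  have hc₃ : (k + 4) * (ν - 6 - k) = Z + 4 * t := by rw [hZ, ht, hX]; ring
  have hZ4 : 4 * t < Z := by linarith [hc₁ ▸ mul_pos hk (by linarith : 0 < ν - 2 - k)]
  have hZX : Z ≤ X := by rw [hZ]; nlinarith
  have hconst : X * (X + 4) * X < p * ((Z - 4 * t) * (Z + 4) * (Z + 4 * t)) := by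
    have : p * (k * (ν - 2 - k) * ((k + 2) * (ν - 4 - k)) * ((k + 4) * (ν - 6 - k)))
        - X * (X + 4) * X = josephLundgrenCubic ν ((ν / 2 - 4 - k) ^ 2) := by
      rw [hX, josephLundgrenCubic]
      linear_combination (ν - 2 - k) * ((k + 2) * (ν - 4 - k)) * ((k + 4) * (ν - 6 - k)) * hpk
    rw [hc₁, hc₂, hc₃] at this
    linarith
  have hlinear := lt_mul_of_mul_le_mul (by linarith) (by positivity) (by positivity) hconst
    (esymm_two_mul_le ht0.le hZ4 hZX)
  have hquadratic := lt_mul_of_mul_le_mul (by linarith) (by positivity) (by positivity) hlinear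
    (esymm_one_mul_le ht0.le hZ4 hZX)
  rw [angularSymbol_eq_toPoly hc₁ hc₂ hc₃, angularSymbol_eq_toPoly (a := X) (b := X + 4) (c := X)
    (by rw [hX]; ring) (by rw [hX]; ring) (by rw [hX]; ring)]
  fin_cases i
  · simpa using hconst
  · simpa using hlinear
  · simpa using hquadratic
  · simpa using hp

theorem exists_lt_one_forall_le_mul {ι : Type*} [Finite ι] {f g : ι → ℝ} (h : ∀ i, f i < g i) :
    ∃ κ : ℝ, 0 < κ ∧ κ < 1 ∧ ∀ i, f i ≤ κ * g i := by
  have hle : ∀ᶠ κ in nhdsWithin (1 : ℝ) (Set.Iio 1), ∀ i, f i ≤ κ * g i := by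
    refine Filter.eventually_all.mpr fun i => nhdsWithin_le_nhds ?_
    have hcont : ContinuousAt (fun κ : ℝ => κ * g i) 1 := by fun_prop
    exact (hcont.eventually (lt_mem_nhds (by simpa using h i))).mono fun _ => le_of_lt
  obtain ⟨κ, hκ, hκ0, hκ1⟩ := (hle.and (Ioo_mem_nhdsLT one_pos)).exists
  exact ⟨κ, hκ0, hκ1, hκ⟩

theorem exists_coeff_angularSymbol_le {n : ℕ} (hn : 7 ≤ n) {p : ℝ}
    (hp : ((n : ℝ) + 6) / ((n : ℝ) - 6) < p) (hpc : (p : EReal) < josephLundgrenExponent n) :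
    ∃ κ : ℝ, 0 < κ ∧ κ < 1 ∧ ∀ i, (angularSymbol n (n / 2 - 3)).coeff i
      ≤ κ * (p * (angularSymbol n (6 / (p - 1))).coeff i) := by
  have hn' : (7 : ℝ) ≤ n := by exact_mod_cast hn
  obtain ⟨hp1, hk1⟩ := one_lt_and_div_lt (by linarith) hp
  have hp0 : 0 < p - 1 := by linarith
  have hpk : p * (6 / (p - 1)) = 6 / (p - 1) + 6 := by field_simp; ring
  obtain ⟨κ, hκ0, hκ1, hκ⟩ := exists_lt_one_forall_le_mul
    (coeff_angularSymbol_lt (div_pos (by norm_num) hp0) hk1 hpk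
      (josephLundgrenCubic_pos_of_lt_exponent hn hp hpc))
  refine ⟨κ, hκ0, hκ1, fun i => ?_⟩
  rcases lt_or_ge i 4 with hi | hi
  · exact hκ ⟨i, hi⟩
  · simp only [angularSymbol_eq_toPoly rfl rfl rfl, Cubic.coeff_eq_zero (show 3 < i from hi),
      mul_zero, le_refl]

/-! ### Partial derivatives and test functions -/

section TestFunctions

variable {n : ℕ} {f g : E n → ℝ} {Ω : Set (E n)}

/-- The partial derivative `∂ᵢ f`. -/
def pderiv (i : Fin n) (f : E n → ℝ) : E n → ℝ :=
  fun x => fderiv ℝ f x (EuclideanSpace.single i 1)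

theorem contDiff_pderiv (hf : ContDiff ℝ ∞ f) (i : Fin n) : ContDiff ℝ ∞ (pderiv i f) :=
  (hf.fderiv_right (m := ∞) (by simp)).clm_apply contDiff_const

theorem pderiv_pderiv_apply {x : E n} (hf : ContDiffAt ℝ 2 f x) (i j : Fin n) :
    pderiv i (pderiv j f) x = iteratedFDeriv ℝ 2 f x
      ![EuclideanSpace.single i 1, EuclideanSpace.single j 1] := by
  have hdiff : DifferentiableAt ℝ (fderiv ℝ f) x :=
    (hf.fderiv_right (m := 1) (by norm_num)).differentiableAt (by norm_num)
  unfold pderiv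
  rw [iteratedFDeriv_two_apply, fderiv_clm_apply hdiff (differentiableAt_const _)]
  simp

theorem pderiv_comm (hf : ContDiff ℝ ∞ f) (i j : Fin n) :
    pderiv i (pderiv j f) = pderiv j (pderiv i f) := by
  ext x
  have hf₂ : ContDiffAt ℝ 2 f x := hf.contDiffAt.of_le (by norm_cast)
  rw [pderiv_pderiv_apply hf₂, pderiv_pderiv_apply hf₂, iteratedFDeriv_two_apply,
    iteratedFDeriv_two_apply]
  exact hf₂.isSymmSndFDerivAt (by simp) _ _

theorem laplacian_apply_eq_sum_pderiv {x : E n} (hf : ContDiffAt ℝ 2 f x) :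
    (Δ f) x = ∑ i, pderiv i (pderiv i f) x := by
  rw [InnerProductSpace.laplacian_eq_iteratedFDeriv_orthonormalBasis f
    (EuclideanSpace.basisFun (Fin n) ℝ)]
  refine Finset.sum_congr rfl fun i _ => ?_
  rw [pderiv_pderiv_apply hf]
  simp only [EuclideanSpace.basisFun_apply]

theorem laplacian_eq_sum_pderiv (hf : ContDiff ℝ ∞ f) :
    Δ f = fun x => ∑ i, pderiv i (pderiv i f) x :=
  funext fun _ => laplacian_apply_eq_sum_pderiv (hf.contDiffAt.of_le (by norm_cast))

theorem contDiff_laplacian (hf : ContDiff ℝ ∞ f) : ContDiff ℝ ∞ (Δ f) := by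
  rw [laplacian_eq_sum_pderiv hf]
  exact ContDiff.sum fun i _ => contDiff_pderiv (contDiff_pderiv hf i) i

theorem laplacian_add (hf : ContDiff ℝ ∞ f) (hg : ContDiff ℝ ∞ g) : Δ (f + g) = Δ f + Δ g :=
  funext fun _ => ContDiffAt.laplacian_add (hf.contDiffAt.of_le (by norm_cast))
    (hg.contDiffAt.of_le (by norm_cast))

theorem pderiv_laplacian (hf : ContDiff ℝ ∞ f) (i : Fin n) :
    pderiv i (Δ f) = Δ (pderiv i f) := by
  rw [laplacian_eq_sum_pderiv hf, laplacian_eq_sum_pderiv (contDiff_pderiv hf i)]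
  ext x
  have hdiff : ∀ j ∈ Finset.univ, DifferentiableAt ℝ (pderiv j (pderiv j f)) x := fun j _ =>
    (contDiff_pderiv (contDiff_pderiv hf j) j).differentiable (by simp) x
  calc _ = ∑ j, pderiv i (pderiv j (pderiv j f)) x := by
        rw [pderiv, fderiv_fun_sum hdiff, _root_.sum_apply]; rfl
    _ = _ := by simp only [pderiv_comm (contDiff_pderiv hf _) i, pderiv_comm hf i]

theorem gradient_apply (f : E n → ℝ) (x : E n) (i : Fin n) : gradient f x i = pderiv i f x := by
  rw [pderiv, ← inner_gradient_left, EuclideanSpace.inner_single_right]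
  simp

theorem norm_gradient_sq (f : E n → ℝ) (x : E n) :
    ‖gradient f x‖ ^ 2 = ∑ i, pderiv i f x * pderiv i f x := by
  simp only [EuclideanSpace.norm_sq_eq, gradient_apply, Real.norm_eq_abs, sq_abs, ← sq]

theorem tsupport_pderiv_subset (f : E n → ℝ) (i : Fin n) : tsupport (pderiv i f) ⊆ tsupport f :=
  tsupport_fderiv_apply_subset ℝ _

theorem tsupport_laplacian_subset (hf : ContDiff ℝ ∞ f) : tsupport (Δ f) ⊆ tsupport f := by
  rw [laplacian_eq_sum_pderiv hf]
  refine closure_minimal (fun x hx => ?_) (isClosed_tsupport f)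
  contrapose! hx
  refine Function.notMem_support.mpr (Finset.sum_eq_zero fun i _ => ?_)
  exact image_eq_zero_of_notMem_tsupport fun hx' =>
    hx (tsupport_pderiv_subset f i (tsupport_pderiv_subset _ i hx'))

theorem IsTestFunction.pderiv (hf : IsTestFunction Ω f) (i : Fin n) :
    IsTestFunction Ω (pderiv i f) :=
  ⟨contDiff_pderiv hf.1 i, hf.2.1.fderiv_apply ℝ _, (tsupport_pderiv_subset f i).trans hf.2.2⟩

theorem IsTestFunction.laplacian (hf : IsTestFunction Ω f) : IsTestFunction Ω (Δ f) :=
  ⟨contDiff_laplacian hf.1, hf.2.1.of_isClosed_subset (isClosed_tsupport _)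
    (tsupport_laplacian_subset hf.1), (tsupport_laplacian_subset hf.1).trans hf.2.2⟩

theorem IsTestFunction.integrable_mul (hg : IsTestFunction Ω g)
    (hf : LocallyIntegrableOn f Ω volume) : Integrable (fun x => f x * g x) := by
  have hint := (hf.integrableOn_compact_subset hg.2.2 hg.2.1).mul_continuousOn
    hg.1.continuous.continuousOn hg.2.1
  refine (integrableOn_iff_integrable_of_support_subset fun x hx => ?_).mp hint
  contrapose! hx
  simp [image_eq_zero_of_notMem_tsupport hx]

theorem IsTestFunction.integrable_continuous_mul (hg : IsTestFunction Ω g) (hf : Continuous f) :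
    Integrable (fun x => f x * g x) :=
  hg.integrable_mul (hf.locallyIntegrable.locallyIntegrableOn Ω)

theorem integral_pderiv_mul (hf : ContDiff ℝ ∞ f) (hg : IsTestFunction Ω g) (i : Fin n) :
    ∫ x, pderiv i f x * g x = -∫ x, f x * pderiv i g x := by
  refine (neg_eq_iff_eq_neg.mpr ?_).symm
  exact integral_mul_fderiv_eq_neg_fderiv_mul_of_integrable
    (hg.integrable_continuous_mul (contDiff_pderiv hf i).continuous)
    ((hg.pderiv i).integrable_continuous_mul hf.continuous)
    (hg.integrable_continuous_mul hf.continuous)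
    (fun x _ => hf.differentiable (by simp) x) (fun x _ => hg.1.differentiable (by simp) x)

theorem sum_integral_pderiv_mul_pderiv (hf : ContDiff ℝ ∞ f) (hg : IsTestFunction Ω g) :
    ∑ i, ∫ x, pderiv i f x * pderiv i g x = -∫ x, f x * (Δ g) x := by
  simp only [laplacian_eq_sum_pderiv hg.1, Finset.mul_sum]
  rw [integral_finsetSum, ← Finset.sum_neg_distrib]
  · exact Finset.sum_congr rfl fun i _ => integral_pderiv_mul hf (hg.pderiv i) i
  · exact fun i _ => ((hg.pderiv i).pderiv i).integrable_continuous_mul hf.continuous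

theorem integral_laplacian_mul (hf : IsTestFunction Ω f) (hg : IsTestFunction Ω g) :
    ∫ x, (Δ f) x * g x = ∫ x, f x * (Δ g) x := by
  have hfg := sum_integral_pderiv_mul_pderiv hf.1 hg
  have hgf := sum_integral_pderiv_mul_pderiv hg.1 hf
  simp only [mul_comm (pderiv _ g _)] at hgf
  simp only [mul_comm ((Δ f) _)]
  linarith

theorem integral_norm_gradient_laplacian_sq (hf : IsTestFunction Ω f) :
    ∫ x, ‖gradient (Δ f) x‖ ^ 2 = -∫ x, f x * (Δ (Δ (Δ f))) x := by
  have hΔf := hf.laplacian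
  simp only [norm_gradient_sq]
  rw [integral_finsetSum, sum_integral_pderiv_mul_pderiv hΔf.1 hΔf,
    integral_laplacian_mul hf hΔf.laplacian]
  exact fun i _ => (hΔf.pderiv i).integrable_continuous_mul (hΔf.pderiv i).1.continuous

/-! ### The very weak form of the equation -/

/-- `u` solves `(-Δ)³ u = |u|^{p-1} u` on `Ω` in the sense of distributions. -/
def IsDistributionalSolution (Ω : Set (E n)) (p : ℝ) (u : E n → ℝ) : Prop :=
  ∀ φ : E n → ℝ, IsTestFunction Ω φ →
    ∫ x, |u x| ^ (p - 1) * u x * φ x = -∫ x, u x * (Δ (Δ (Δ φ))) x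

theorem MemL2Loc.locallyIntegrableOn {F : Type*} [NormedAddCommGroup F] {v : E n → F}
    (hΩ : IsOpen Ω) (hv : MemL2Loc Ω v) : LocallyIntegrableOn v Ω volume := by
  refine (locallyIntegrableOn_iff hΩ.isLocallyClosed).mpr fun K hKΩ hK => ?_
  have : IsFiniteMeasure (volume.restrict K) := ⟨by simpa using hK.measure_lt_top⟩
  exact (hv K hK hKΩ).integrable (by norm_num)

theorem IsWeakGradLaplacian.integral_apply_mul {u : E n → ℝ} {G : E n → E n} (hΩ : IsOpen Ω)
    (hu : LocallyIntegrableOn u Ω volume) (hG : IsWeakGradLaplacian Ω u G) {φ : E n → ℝ}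
    (hφ : IsTestFunction Ω φ) (i : Fin n) :
    Integrable (fun x => G x i * φ x) ∧
      ∫ x, G x i * φ x = -∫ x, u x * pderiv i (Δ φ) x := by
  have hGj (j : Fin n) : Integrable fun x => G x j * φ x :=
    hφ.integrable_mul (fun x hx => (hG.1.locallyIntegrableOn hΩ x hx).imp fun s hs =>
      ⟨hs.1, hs.2.eval_piLp j⟩)
  have huj (j : Fin n) : Integrable fun x => u x * pderiv j (Δ φ) x :=
    (hφ.laplacian.pderiv j).integrable_mul hu
  refine ⟨hGj i, ?_⟩
  have hvec := congrArg (fun v : E n => v i) (hG.2 φ hφ)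
  rw [PiLp.neg_apply, eval_integral_piLp fun j => by simpa [mul_comm] using hGj j,
    eval_integral_piLp fun j => by simpa [gradient_apply] using huj j] at hvec
  simpa [gradient_apply, mul_comm (φ _)] using hvec

theorem IsWeakSolution.isDistributionalSolution {p : ℝ} {u : E n → ℝ} (hΩ : IsOpen Ω)
    (hu : LocallyIntegrableOn u Ω volume) (h : IsWeakSolution Ω p u) :
    IsDistributionalSolution Ω p u := by
  intro φ hφ
  obtain ⟨G, hG, hsol⟩ := h
  have hΔφ := hφ.laplacian
  calc ∫ x, |u x| ^ (p - 1) * u x * φ x = ∫ x, ∑ i, G x i * pderiv i (Δ φ) x := by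
        rw [← hsol φ hφ]
        simp only [PiLp.inner_apply, gradient_apply, RCLike.inner_apply, conj_trivial, mul_comm]
    _ = ∑ i, -∫ x, u x * pderiv i (Δ (pderiv i (Δ φ))) x := by
        rw [integral_finsetSum _ fun i _ => (hG.integral_apply_mul hΩ hu (hΔφ.pderiv i) i).1]
        exact Finset.sum_congr rfl fun i _ => (hG.integral_apply_mul hΩ hu (hΔφ.pderiv i) i).2
    _ = _ := by
        simp only [← pderiv_laplacian hΔφ.1, laplacian_eq_sum_pderiv hΔφ.laplacian.1,
          Finset.mul_sum]
        rw [integral_finsetSum _ fun i _ =>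
          ((hΔφ.laplacian.pderiv i).pderiv i).integrable_mul hu, Finset.sum_neg_distrib]

end TestFunctions

/-! ### Homogeneous functions of degree zero -/

/-- Functions on `ℝⁿ` that are smooth away from the origin and homogeneous of degree zero: the
smooth functions on the sphere, extended radially. They vanish at the origin by convention. -/
def HomZero (n : ℕ) : NonUnitalSubalgebra ℝ (E n → ℝ) where
  carrier := {q | ContDiffOn ℝ ∞ q {0}ᶜ ∧ (∀ c : ℝ, 0 < c → ∀ x, q (c • x) = q x) ∧ q 0 = 0}
  zero_mem' := ⟨contDiffOn_const, by simp, rfl⟩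
  add_mem' := fun ⟨hf, hf', hf₀⟩ ⟨hg, hg', hg₀⟩ =>
    ⟨hf.add hg, fun c hc x => by simp [hf' c hc, hg' c hc], by simp [hf₀, hg₀]⟩
  mul_mem' := fun ⟨hf, hf', hf₀⟩ ⟨hg, hg', _⟩ =>
    ⟨hf.mul hg, fun c hc x => by simp [hf' c hc, hg' c hc], by simp [hf₀]⟩
  smul_mem' := fun _ _ ⟨hf, hf', hf₀⟩ =>
    ⟨contDiffOn_const.smul hf, fun c hc x => by simp [hf' c hc], by simp [hf₀]⟩

namespace HomZero

variable {n : ℕ}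

instance : CoeFun (HomZero n) fun _ => E n → ℝ := ⟨Subtype.val⟩

theorem apply_smul (q : HomZero n) {c : ℝ} (hc : 0 < c) (x : E n) : q (c • x) = q x :=
  q.2.2.1 c hc x

theorem apply_zero (q : HomZero n) : q 0 = 0 := q.2.2.2

theorem apply_normalize (q : HomZero n) (x : E n) : q (‖x‖⁻¹ • x) = q x := by
  rcases eq_or_ne x 0 with rfl | hx
  · simp
  · exact apply_smul q (inv_pos.mpr (norm_pos_iff.mpr hx)) x

theorem ext_of_ne_zero {f g : HomZero n} (h : ∀ x ≠ 0, f x = g x) : f = g := by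
  ext x
  rcases eq_or_ne x 0 with rfl | hx
  · rw [apply_zero, apply_zero]
  · exact h x hx

theorem contDiffAt (q : HomZero n) {x : E n} (hx : x ≠ 0) : ContDiffAt ℝ ∞ q x :=
  q.2.1.contDiffAt (isOpen_compl_singleton.mem_nhds hx)

theorem differentiableAt (q : HomZero n) {x : E n} (hx : x ≠ 0) : DifferentiableAt ℝ q x :=
  (contDiffAt q hx).differentiableAt (by simp)

theorem fderiv_smul (q : HomZero n) {c : ℝ} (hc : 0 < c) (x : E n) :
    fderiv ℝ q (c • x) = c⁻¹ • fderiv ℝ q x := by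
  have hcomp := fderiv_comp_smul (𝕜 := ℝ) (f := q) (x := x) (c := c)
  simp only [apply_smul q hc] at hcomp
  rw [hcomp, smul_smul, inv_mul_cancel₀ hc.ne', one_smul]

theorem fderiv_apply_self (q : HomZero n) (x : E n) : fderiv ℝ q x x = 0 := by
  rcases eq_or_ne x 0 with rfl | hx
  · simp
  have hray : HasDerivAt (fun t : ℝ => q (t • x)) (fderiv ℝ q x x) 1 := by
    have hq : HasFDerivAt q (fderiv ℝ q x) ((1 : ℝ) • x) := by
      rw [one_smul]
      exact (differentiableAt q hx).hasFDerivAt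
    exact hq.comp_hasDerivAt 1 (by simpa using (hasDerivAt_id (1 : ℝ)).smul_const x)
  have hconst : (fun t : ℝ => q (t • x)) =ᶠ[nhds 1] fun _ => q x := by
    filter_upwards [lt_mem_nhds one_pos] with t ht using apply_smul q ht x
  exact hray.unique ((hasDerivAt_const (1 : ℝ) (q x)).congr_of_eventuallyEq hconst)

/-- The unit of `HomZero n`: the function `1` away from the origin. -/
def unit (n : ℕ) : HomZero n := ⟨fun x => if x = 0 then 0 else 1,
  (contDiffOn_const (c := (1 : ℝ))).congr fun _ hx => if_neg hx,
  fun c hc x => by simp [hc.ne'], if_pos rfl⟩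

theorem unit_apply {x : E n} (hx : x ≠ 0) : unit n x = 1 := if_neg hx

theorem unit_mul (q : HomZero n) : unit n * q = q :=
  ext_of_ne_zero fun x hx => by simp [unit_apply hx]

/-- The coordinate functions `xᵢ / ‖x‖`. -/
def coord (i : Fin n) : HomZero n := ⟨fun x => x i / ‖x‖,
  ContDiffOn.div (by fun_prop) (fun _ hx => (contDiffAt_norm ℝ hx).contDiffWithinAt)
    fun _ hx => norm_ne_zero_iff.mpr hx,
  fun c hc x => by simp [norm_smul, abs_of_pos hc, mul_div_mul_left _ _ hc.ne'], by simp⟩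

theorem coord_apply (i : Fin n) (x : E n) : coord i x = x i / ‖x‖ := rfl

theorem sum_apply {ι : Type*} (s : Finset ι) (f : ι → HomZero n) (x : E n) :
    (∑ i ∈ s, f i) x = ∑ i ∈ s, f i x := by
  rw [AddSubmonoidClass.coe_finsetSum, Finset.sum_apply]

theorem sum_coord_mul_self : ∑ i, coord i * coord i = unit n := by
  refine ext_of_ne_zero fun x hx => ?_
  have hnorm : ‖x‖ ^ 2 ≠ 0 := pow_ne_zero 2 (norm_ne_zero_iff.mpr hx)
  calc (∑ i, coord i * coord i) x = ∑ i, x i ^ 2 / ‖x‖ ^ 2 := by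
        rw [sum_apply]
        exact Finset.sum_congr rfl fun i _ => by simp [coord_apply]; ring
    _ = unit n x := by
        rw [unit_apply hx, ← Finset.sum_div, div_eq_one_iff_eq hnorm]
        simp [EuclideanSpace.norm_sq_eq]

/-- The angular derivative `‖x‖ ∂ᵢ`. -/
def ang (i : Fin n) : HomZero n →ₗ[ℝ] HomZero n where
  toFun q := ⟨fun x => ‖x‖ * pderiv i q x,
    ContDiffOn.mul (fun _ hx => (contDiffAt_norm ℝ hx).contDiffWithinAt)
      ((q.2.1.fderiv_of_isOpen (m := ∞) isOpen_compl_singleton (by simp)).clm_apply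
        contDiffOn_const),
    fun c hc x => by
      simp only [pderiv, fderiv_smul q hc, norm_smul, Real.norm_eq_abs, abs_of_pos hc,
        _root_.smul_apply, smul_eq_mul]
      field_simp,
    by simp⟩
  map_add' q r := ext_of_ne_zero fun x hx => by
    simp [pderiv, fderiv_add (differentiableAt q hx) (differentiableAt r hx), mul_add]
  map_smul' c q := ext_of_ne_zero fun x hx => by
    simp [pderiv, fderiv_const_smul (differentiableAt q hx), mul_left_comm]

theorem ang_apply (i : Fin n) (q : HomZero n) (x : E n) : ang i q x = ‖x‖ * pderiv i q x := rfl

theorem ang_mul (i : Fin n) (f g : HomZero n) : ang i (f * g) = f * ang i g + g * ang i f := by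
  refine ext_of_ne_zero fun x hx => ?_
  simp only [ang_apply, pderiv, MulMemClass.coe_mul, AddMemClass.coe_add, Pi.add_apply,
    Pi.mul_apply, fderiv_mul (differentiableAt f hx) (differentiableAt g hx),
    _root_.add_apply, _root_.smul_apply, smul_eq_mul]
  ring

theorem ang_unit (i : Fin n) : ang i (unit n) = 0 := by
  have hmul := ang_mul i (unit n) (unit n)
  rw [unit_mul, unit_mul] at hmul
  exact left_eq_add.mp hmul

theorem sum_coord_mul_ang (q : HomZero n) : ∑ i, coord i * ang i q = 0 := by
  refine ext_of_ne_zero fun x hx => ?_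
  have hnorm : ‖x‖ ≠ 0 := norm_ne_zero_iff.mpr hx
  have hbasis : x = ∑ i, x i • EuclideanSpace.single i (1 : ℝ) := by
    ext j; simp [Pi.single_apply]
  calc (∑ i, coord i * ang i q) x = ∑ i, x i * pderiv i q x := by
        rw [sum_apply]
        refine Finset.sum_congr rfl fun i _ => ?_
        simp only [MulMemClass.coe_mul, Pi.mul_apply, coord_apply, ang_apply]
        field_simp
    _ = fderiv ℝ q x (∑ i, x i • EuclideanSpace.single i (1 : ℝ)) := by
        simp only [map_sum, map_smul, smul_eq_mul, pderiv]
    _ = 0 := by rw [← hbasis, fderiv_apply_self]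

theorem pderiv_norm {x : E n} (hx : x ≠ 0) (i : Fin n) :
    pderiv i (fun y => ‖y‖) x = x i / ‖x‖ := by
  have hnorm : ‖x‖ ≠ 0 := norm_ne_zero_iff.mpr hx
  have hsqrt := ((hasStrictFDerivAt_norm_sq x).hasFDerivAt.sqrt (pow_ne_zero 2 hnorm)).fderiv
  simp only [Real.sqrt_sq (norm_nonneg _)] at hsqrt
  rw [pderiv, hsqrt]
  simp only [_root_.smul_apply, innerSL_apply_apply, EuclideanSpace.inner_single_right,
    smul_eq_mul, nsmul_eq_mul, conj_trivial]
  field_simp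
  norm_num

theorem pderiv_proj (i j : Fin n) (x : E n) :
    pderiv i (fun y => y j) x = if i = j then 1 else 0 := by
  have : (fun y : E n => y j) = EuclideanSpace.proj (𝕜 := ℝ) j := rfl
  rw [pderiv, this, ContinuousLinearMap.fderiv]
  simp [eq_comm]

theorem ang_coord (i j : Fin n) :
    ang i (coord j) = (if i = j then unit n else 0) - coord i * coord j := by
  refine ext_of_ne_zero fun x hx => ?_
  have hmul : (fun y : E n => y j) = fun y => ‖y‖ * coord j y := by
    ext y
    rcases eq_or_ne y 0 with rfl | hy
    · simp
    · exact (mul_div_cancel₀ (y j) (norm_ne_zero_iff.mpr hy)).symm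
  have hproduct : pderiv i (fun y => y j) x
      = ang i (coord j) x + coord j x * pderiv i (fun y => ‖y‖) x := by
    rw [hmul, pderiv, fderiv_fun_mul ((contDiffAt_norm ℝ hx).differentiableAt (n := ∞) (by simp))
      (differentiableAt _ hx)]
    rfl
  rw [pderiv_proj, pderiv_norm hx, ← sub_eq_iff_eq_add] at hproduct
  rw [← hproduct]
  split_ifs
  · simp [unit_apply hx, coord_apply, mul_comm]
  · simp [coord_apply, mul_comm]

/-- The operator `-Δ_S`, the positive Laplace–Beltrami operator of the sphere, on homogeneous
functions of degree zero. -/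
def negLap : Module.End ℝ (HomZero n) := -∑ i : Fin n, ang i * ang i

theorem negLap_apply (q : HomZero n) : negLap q = -∑ i, ang i (ang i q) := by simp [negLap]

theorem negLap_mul (f g : HomZero n) :
    negLap (f * g) = f * negLap g + g * negLap f - (2 : ℝ) • ∑ i, ang i f * ang i g := by
  ext x
  simp only [negLap_apply, ang_mul, map_add, MulMemClass.coe_mul, AddMemClass.coe_add, sum_apply,
    AddSubgroupClass.coe_sub, NegMemClass.coe_neg, SetLike.val_smul, Pi.add_apply, Pi.sub_apply,
    Pi.mul_apply, Pi.neg_apply, Pi.smul_apply, smul_eq_mul, Finset.mul_sum,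
    ← Finset.sum_neg_distrib, ← Finset.sum_add_distrib, ← Finset.sum_sub_distrib]
  exact Finset.sum_congr rfl fun i _ => by ring

end HomZero

/-! ### Separated functions -/

/-- Smooth compactly supported functions on the line. -/
def Profile : Submodule ℝ (ℝ → ℝ) where
  carrier := {η | ContDiff ℝ ∞ η ∧ HasCompactSupport η}
  zero_mem' := ⟨contDiff_const, HasCompactSupport.zero⟩
  add_mem' := fun ⟨hη, hη'⟩ ⟨hζ, hζ'⟩ => ⟨hη.add hζ, hη'.add hζ'⟩
  smul_mem' := fun r _ ⟨hη, hη'⟩ => ⟨contDiff_const.smul hη, hη'.smul_left (f := fun _ => r)⟩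

namespace Profile

instance : CoeFun Profile fun _ => ℝ → ℝ := ⟨Subtype.val⟩

theorem contDiff (η : Profile) : ContDiff ℝ ∞ η := η.2.1

theorem differentiable (η : Profile) : Differentiable ℝ η := (contDiff η).differentiable (by simp)

theorem hasCompactSupport (η : Profile) : HasCompactSupport η := η.2.2

theorem continuous (η : Profile) : Continuous η := (contDiff η).continuous

theorem integrable (η : Profile) : Integrable η :=
  (continuous η).integrable_of_hasCompactSupport (hasCompactSupport η)

/-- Differentiation of profiles. -/
def der : Module.End ℝ Profile where
  toFun η := ⟨deriv η, (contDiff η).deriv', (hasCompactSupport η).deriv⟩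
  map_add' η ζ := Subtype.ext (funext fun s => deriv_add (differentiable η s) (differentiable ζ s))
  map_smul' c η := Subtype.ext (funext fun s => deriv_const_smul c (differentiable η s))

theorem hasDerivAt (η : Profile) (s : ℝ) : HasDerivAt η (der η s) s :=
  (differentiable η s).hasDerivAt

theorem integral_der (η : Profile) : ∫ s, der η s = 0 :=
  integral_eq_zero_of_hasDerivAt_of_integrable (hasDerivAt η) (integrable (der η)) (integrable η)

end Profile

open HomZero Profile

variable {n : ℕ}

/-- The separated function `‖x‖ᵃ η(log ‖x‖) q(x)`, bilinear in `η` and `q`. -/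
def sep (a : ℝ) : Profile →ₗ[ℝ] HomZero n →ₗ[ℝ] (E n → ℝ) :=
  LinearMap.mk₂ ℝ (fun η q x => ‖x‖ ^ a * η (Real.log ‖x‖) * q x)
    (fun _ _ _ => by ext; simp; ring) (fun _ _ _ => by ext; simp; ring)
    (fun _ _ _ => by ext; simp; ring) (fun _ _ _ => by ext; simp; ring)

theorem sep_apply (a : ℝ) (η : Profile) (q : HomZero n) (x : E n) :
    sep a η q x = ‖x‖ ^ a * η (Real.log ‖x‖) * q x := rfl

theorem sep_apply_zero (a : ℝ) (η : Profile) (q : HomZero n) : sep a η q 0 = 0 := by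
  rw [sep_apply, apply_zero, mul_zero]

/-- The compact shell that carries `sep a η q`. -/
def shell (n : ℕ) (η : Profile) : Set (E n) := {x | ‖x‖ ∈ Real.exp '' tsupport η}

theorem isCompact_shell (η : Profile) : IsCompact (shell n η) := by
  have hcompact : IsCompact (Real.exp '' tsupport η) :=
    (hasCompactSupport η).isCompact.image Real.continuous_exp
  refine Metric.isCompact_of_isClosed_isBounded (hcompact.isClosed.preimage continuous_norm) ?_
  obtain ⟨R, hR⟩ := hcompact.isBounded.subset_closedBall 0
  exact (Metric.isBounded_closedBall (x := (0 : E n)) (r := R)).subset fun x hx => by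
    simpa using hR hx

theorem shell_subset (η : Profile) : shell n η ⊆ {0}ᶜ := by
  rintro x ⟨s, -, hs⟩ (rfl : x = 0)
  rw [norm_zero] at hs
  exact (Real.exp_pos s).ne' hs

theorem tsupport_sep_subset (a : ℝ) (η : Profile) (q : HomZero n) :
    tsupport (sep a η q) ⊆ shell n η := by
  refine closure_minimal (fun x hx => ?_) (isCompact_shell η).isClosed
  have hx₀ : x ≠ 0 := fun h => hx (h ▸ sep_apply_zero a η q)
  refine ⟨Real.log ‖x‖, subset_tsupport _ fun h => hx ?_, Real.exp_log (norm_pos_iff.mpr hx₀)⟩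
  rw [sep_apply, h, mul_zero, zero_mul]

theorem contDiff_sep (a : ℝ) (η : Profile) (q : HomZero n) : ContDiff ℝ ∞ (sep a η q) := by
  refine contDiff_iff_contDiffAt.mpr fun x => ?_
  rcases eq_or_ne x 0 with rfl | hx
  · have hnotMem : (0 : E n) ∉ tsupport (sep a η q) := fun h =>
      shell_subset η (tsupport_sep_subset a η q h) rfl
    exact contDiffAt_const.congr_of_eventuallyEq
      (notMem_tsupport_iff_eventuallyEq.mp hnotMem)
  · have hnorm : ‖x‖ ≠ 0 := norm_ne_zero_iff.mpr hx
    have hsmooth : ContDiffAt ℝ ∞ (fun y : E n => ‖y‖) x := contDiffAt_norm ℝ hx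
    exact ((hsmooth.rpow_const_of_ne hnorm).mul
      ((contDiff η).contDiffAt.comp x (hsmooth.log hnorm))).mul (contDiffAt q hx)

theorem isTestFunction_sep (a : ℝ) (η : Profile) (q : HomZero n) :
    IsTestFunction {0}ᶜ (sep a η q) :=
  ⟨contDiff_sep a η q, (isCompact_shell η).of_isClosed_subset (isClosed_tsupport _)
    (tsupport_sep_subset a η q), (tsupport_sep_subset a η q).trans (shell_subset η)⟩

theorem pderiv_sep (a : ℝ) (η : Profile) (q : HomZero n) (i : Fin n) :
    pderiv i (sep a η q) = sep (a - 1) (a • η + der η) (coord i * q) + sep (a - 1) η (ang i q) := by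
  ext x
  rcases eq_or_ne x 0 with rfl | hx
  · have hnotMem : (0 : E n) ∉ tsupport (pderiv i (sep a η q)) := fun h =>
      shell_subset η (tsupport_sep_subset a η q (tsupport_pderiv_subset _ i h)) rfl
    simp only [image_eq_zero_of_notMem_tsupport hnotMem, Pi.add_apply, sep_apply_zero, add_zero]
  have hr : 0 < ‖x‖ := norm_pos_iff.mpr hx
  have hradial : HasDerivAt (fun r : ℝ => r ^ a * η (Real.log r))
      (‖x‖ ^ (a - 1) * (a • η + der η : Profile) (Real.log ‖x‖)) ‖x‖ := by
    refine ((Real.hasDerivAt_rpow_const (x := ‖x‖) (p := a) (Or.inl hr.ne')).mul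
      ((hasDerivAt η _).comp ‖x‖ (Real.hasDerivAt_log hr.ne'))).congr_deriv ?_
    simp only [Submodule.coe_add, Submodule.coe_smul, Pi.add_apply, Pi.smul_apply, smul_eq_mul,
      Function.comp_apply, Real.rpow_sub_one hr.ne']
    field_simp
  have hsep := ((hradial.comp_hasFDerivAt x ((contDiffAt_norm ℝ hx).differentiableAt
    (n := ∞) (by simp)).hasFDerivAt).mul (differentiableAt q hx).hasFDerivAt).fderiv
  calc pderiv i (sep a η q) x
      = ‖x‖ ^ a * η (Real.log ‖x‖) * pderiv i q x
        + q x * (‖x‖ ^ (a - 1) * (a • η + der η : Profile) (Real.log ‖x‖)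
          * pderiv i (fun y => ‖y‖) x) := congrArg (· (EuclideanSpace.single i 1)) hsep
    _ = _ := by
        simp only [pderiv_norm hx, Pi.add_apply, sep_apply, ang_apply, coord_apply,
          MulMemClass.coe_mul, Pi.mul_apply, Real.rpow_sub_one hr.ne']
        field_simp
        ring

/-- The operator `(∂_s + a) (∂_s + a + n - 2)`, the radial part of `r² Δ` on `rᵃ η(s)`, where
`s = log r`. -/
def radialSymbol (n : ℕ) (a : ℝ) : ℝ[X] := (X + C a) * (X + C (a + n - 2))

theorem pderiv_add {f g : E n → ℝ} (hf : ContDiff ℝ ∞ f) (hg : ContDiff ℝ ∞ g) (i : Fin n) :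
    pderiv i (f + g) = pderiv i f + pderiv i g := by
  ext x
  simp [pderiv, fderiv_add (hf.differentiable (by simp) x) (hg.differentiable (by simp) x)]

theorem pderiv_pderiv_sep (a : ℝ) (η : Profile) (q : HomZero n) (i : Fin n) :
    pderiv i (pderiv i (sep a η q))
      = sep (a - 2) ((a - 1) • (a • η + der η) + der (a • η + der η)) (coord i * coord i * q)
        + sep (a - 2) (a • η + der η) ((unit n - coord i * coord i) * q + coord i * ang i q)
        + (sep (a - 2) ((a - 1) • η + der η) (coord i * ang i q)
        + sep (a - 2) η (ang i (ang i q))) := by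
  rw [pderiv_sep, pderiv_add (contDiff_sep _ _ _) (contDiff_sep _ _ _), pderiv_sep, pderiv_sep,
    ang_mul, ang_coord, if_pos rfl, show a - 1 - 1 = a - 2 by ring, mul_assoc, mul_comm q,
    add_comm (coord i * ang i q)]

theorem laplacian_sep (a : ℝ) (η : Profile) (q : HomZero n) :
    Δ (sep a η q) = sep (a - 2) (aeval der (radialSymbol n a) η) q - sep (a - 2) η (negLap q) := by
  have hcoord : ∑ i, coord i * coord i * q = q := by
    rw [← Finset.sum_mul, sum_coord_mul_self, unit_mul]
  have hang_coord : ∑ i, (unit n - coord i * coord i) * q + ∑ i, coord i * ang i q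
      = ((n : ℝ) - 1) • q := by
    rw [sum_coord_mul_ang, ← Finset.sum_mul, Finset.sum_sub_distrib,
      sum_coord_mul_self, Finset.sum_const, add_zero, sub_mul, unit_mul, Finset.card_univ,
      Fintype.card_fin, smul_mul_assoc, unit_mul, sub_smul, one_smul, Nat.cast_smul_eq_nsmul]
  have hradial : aeval der (radialSymbol n a) η = (a - 1) • (a • η + der η)
      + der (a • η + der η) + ((n : ℝ) - 1) • (a • η + der η) := by
    simp only [radialSymbol, map_mul, map_add, aeval_X, aeval_C, Module.End.mul_apply,
      LinearMap.add_apply, Module.algebraMap_end_apply, map_smul]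
    module
  have hsum : Δ (sep a η q) = ∑ i, pderiv i (pderiv i (sep a η q)) := by
    rw [laplacian_eq_sum_pderiv (contDiff_sep a η q)]
    exact funext fun x => (Finset.sum_apply x _ _).symm
  simp only [hsum, pderiv_pderiv_sep, Finset.sum_add_distrib, ← map_sum]
  rw [hcoord, hang_coord, sum_coord_mul_ang, hradial, negLap_apply]
  simp only [map_add, map_smul, map_neg, LinearMap.add_apply, LinearMap.smul_apply, map_zero]
  module

theorem IsTestFunction.add {Ω : Set (E n)} {f g : E n → ℝ} (hf : IsTestFunction Ω f)
    (hg : IsTestFunction Ω g) : IsTestFunction Ω (f + g) :=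
  ⟨hf.1.add hg.1, hf.2.1.add hg.2.1,
    (tsupport_add f g).trans (Set.union_subset hf.2.2 hg.2.2)⟩

/-- `P(∂_s, -Δ_S)` acting on the radial and the angular factor of `sep a η q`. The inner variable of
`P` stands for `∂_s`, the outer one for `-Δ_S`. -/
def sepAeval (a : ℝ) (η : Profile) (q : HomZero n) : ℝ[X][X] →ₗ[ℝ] (E n → ℝ) :=
  lsum fun j => (sep a).flip ((negLap ^ j) q) ∘ₗ LinearMap.applyₗ η ∘ₗ (aeval der).toLinearMap

theorem sepAeval_apply (a : ℝ) (η : Profile) (q : HomZero n) (P : ℝ[X][X]) :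
    sepAeval a η q P = P.sum fun j c => sep a (aeval der c η) ((negLap ^ j) q) := rfl

theorem sepAeval_monomial (a : ℝ) (η : Profile) (q : HomZero n) (j : ℕ) (c : ℝ[X]) :
    sepAeval a η q (monomial j c) = sep a (aeval der c η) ((negLap ^ j) q) := by
  rw [sepAeval_apply, sum_monomial_index]
  simp

theorem isTestFunction_sepAeval (a : ℝ) (η : Profile) (q : HomZero n) (P : ℝ[X][X]) :
    IsTestFunction {0}ᶜ (sepAeval a η q P) := by
  induction P using Polynomial.induction_on' with
  | add P Q hP hQ => rw [map_add]; exact hP.add hQ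
  | monomial j c => rw [sepAeval_monomial]; exact isTestFunction_sep _ _ _

theorem laplacian_sepAeval (a : ℝ) (η : Profile) (q : HomZero n) (P : ℝ[X][X]) :
    Δ (sepAeval a η q P) = sepAeval (a - 2) η q ((C (radialSymbol n a) - X) * P) := by
  induction P using Polynomial.induction_on' with
  | add P Q hP hQ =>
    rw [map_add, laplacian_add (isTestFunction_sepAeval a η q P).1
      (isTestFunction_sepAeval a η q Q).1, hP, hQ, mul_add, map_add]
  | monomial j c =>
    rw [sub_mul, C_mul_monomial, X_mul_monomial, map_sub, sepAeval_monomial, sepAeval_monomial,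
      sepAeval_monomial, laplacian_sep, map_mul, Module.End.mul_apply, pow_succ',
      Module.End.mul_apply]

/-- The operator `r⁶ Δ³` on `rᵃ η(s) q`, as a polynomial in `∂_s` and `-Δ_S`, see `sepAeval`. -/
def triharmonicSymbol (n : ℕ) (a : ℝ) : ℝ[X][X] :=
  (C (radialSymbol n (a - 4)) - X) * ((C (radialSymbol n (a - 2)) - X)
    * (C (radialSymbol n a) - X))

theorem laplacian_cubed_sep (a : ℝ) (η : Profile) (q : HomZero n) :
    Δ (Δ (Δ (sep a η q))) = sepAeval (a - 6) η q (triharmonicSymbol n a) := by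
  have hone : sep a η q = sepAeval a η q 1 := by
    rw [← monomial_zero_one, sepAeval_monomial, map_one, pow_zero]
    rfl
  rw [hone, laplacian_sepAeval, laplacian_sepAeval, laplacian_sepAeval, mul_one,
    show a - 2 - 2 - 2 = a - 6 by ring, show a - 2 - 2 = a - 4 by ring, triharmonicSymbol]

/-- The exponent is chosen so that `r^{-k} · r^{a-6} = r^{-n}`. -/
theorem triharmonicSymbol_map_eval_zero (n : ℕ) (k : ℝ) :
    (triharmonicSymbol n (k + 6 - n)).map (evalRingHom 0) = -angularSymbol n k := by
  simp only [triharmonicSymbol, radialSymbol, angularSymbol, Polynomial.map_mul,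
    Polynomial.map_sub, map_C, map_X, coe_evalRingHom, eval_mul, eval_add, eval_X, eval_C]
  rw [← neg_inj]
  simp only [map_add, map_sub, map_mul, map_natCast, map_ofNat, map_zero]
  ring

/-! ### Polar coordinates -/

section Polar

variable {V : Type*} [NormedAddCommGroup V] [NormedSpace ℝ V]

/-- Polar coordinates `(r, θ) ↦ r θ`. -/
def polarMap (y : Set.Ioi (0 : ℝ) × Metric.sphere (0 : V) 1) : V := (y.1 : ℝ) • (y.2 : V)

theorem norm_polarMap (y : Set.Ioi (0 : ℝ) × Metric.sphere (0 : V) 1) : ‖polarMap y‖ = y.1 := by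
  rw [polarMap, norm_smul, norm_eq_of_mem_sphere, mul_one, Real.norm_eq_abs, abs_of_pos y.1.2]

theorem normalize_polarMap (y : Set.Ioi (0 : ℝ) × Metric.sphere (0 : V) 1) :
    ‖polarMap y‖⁻¹ • polarMap y = y.2 := by
  rw [norm_polarMap, polarMap, smul_smul, inv_mul_cancel₀ (ne_of_gt y.1.2), one_smul]

theorem polarMap_eq : (polarMap : _ → V)
    = Subtype.val ∘ (homeomorphUnitSphereProd V).symm ∘ Prod.swap := by
  ext y
  simp [polarMap]

variable [MeasurableSpace V] {μ : Measure V}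

/-- `u` is almost everywhere homogeneous of degree `b`, with angular factor `w`. Only the values of
`w` on the unit sphere matter. -/
def IsHomogeneousAE (μ : Measure V) (b : ℝ) (w u : V → ℝ) : Prop :=
  ∀ᵐ x ∂μ, u x = ‖x‖ ^ b * w (‖x‖⁻¹ • x)

theorem IsHomogeneousAE.abs_rpow {b : ℝ} {w u : V → ℝ} (hu : IsHomogeneousAE μ b w u)
    (s : ℝ) :
    IsHomogeneousAE μ (b * s) (fun x => |w x| ^ s) fun x => |u x| ^ s := by
  filter_upwards [hu] with x hx
  rw [hx, abs_mul, abs_of_nonneg (Real.rpow_nonneg (norm_nonneg x) b),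
    Real.mul_rpow (Real.rpow_nonneg (norm_nonneg x) b) (abs_nonneg _),
    Real.rpow_mul (norm_nonneg x)]

variable [BorelSpace V] [FiniteDimensional ℝ V]

theorem measurableEmbedding_polarMap : MeasurableEmbedding (polarMap : _ → V) := by
  rw [polarMap_eq]
  exact (MeasurableEmbedding.subtype_coe (measurableSet_singleton _).compl).comp
    ((homeomorphUnitSphereProd V).symm.measurableEmbedding.comp
      MeasurableEquiv.prodComm.measurableEmbedding)

theorem integral_Ioi_eq_integral_log (g : ℝ → ℝ) :
    ∫ r in Set.Ioi (0 : ℝ), r⁻¹ * g (Real.log r) = ∫ s, g s := by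
  have hexp := integral_image_eq_integral_abs_deriv_smul MeasurableSet.univ
    (fun x _ => (Real.hasDerivAt_exp x).hasDerivWithinAt) Real.exp_injective.injOn
    (fun r => r⁻¹ * g (Real.log r))
  rw [Set.image_univ, Real.range_exp, Measure.restrict_univ] at hexp
  rw [hexp]
  refine integral_congr_ae (.of_forall fun s => ?_)
  simp [abs_of_pos (Real.exp_pos s), Real.exp_ne_zero]

theorem integral_volumeIoiPow_log (m : ℕ) (g : ℝ → ℝ) :
    ∫ r : Set.Ioi (0 : ℝ), (r : ℝ) ^ (-((m + 1 : ℕ) : ℝ)) * g (Real.log r)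
      ∂Measure.volumeIoiPow m = ∫ s, g s := by
  simp only [Measure.volumeIoiPow, ENNReal.ofReal]
  rw [integral_withDensity_eq_integral_smul (by fun_prop),
    integral_subtype_comap measurableSet_Ioi fun a : ℝ ↦
      Real.toNNReal (a ^ m) • (a ^ (-((m + 1 : ℕ) : ℝ)) * g (Real.log a)),
    ← integral_Ioi_eq_integral_log]
  refine setIntegral_congr_fun measurableSet_Ioi fun r (hr : 0 < r) => ?_
  simp only [NNReal.smul_def, Real.coe_toNNReal _ (pow_nonneg hr.le m), smul_eq_mul,
    Real.rpow_neg hr.le, Real.rpow_natCast, pow_succ]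
  field_simp

instance (m : ℕ) : NeZero (Measure.volumeIoiPow m) := by
  refine ⟨fun h => ?_⟩
  have hone := Measure.volumeIoiPow_apply_Iio m ⟨1, Set.mem_Ioi.mpr one_pos⟩
  rw [h, Measure.coe_zero, Pi.zero_apply, eq_comm, ENNReal.ofReal_eq_zero] at hone
  exact hone.not_gt (by positivity)

variable [μ.IsAddHaarMeasure] [Nontrivial V]

theorem measurePreserving_polarMap :
    MeasurePreserving polarMap
      ((Measure.volumeIoiPow (Module.finrank ℝ V - 1)).prod μ.toSphere) μ := by
  have hsphere := MeasurePreserving.symm (homeomorphUnitSphereProd V).toMeasurableEquiv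
    μ.measurePreserving_homeomorphUnitSphereProd
  have hval : MeasurePreserving (Subtype.val : ({0}ᶜ : Set V) → V) (μ.comap Subtype.val) μ := by
    refine ⟨measurable_subtype_coe, ?_⟩
    rw [map_comap_subtype_coe (measurableSet_singleton _).compl, restrict_compl_singleton]
  rw [polarMap_eq]
  exact hval.comp (hsphere.comp Measure.measurePreserving_swap)

theorem integral_polar (g : ℝ → ℝ) (v : V → ℝ) :
    ∫ x, ‖x‖ ^ (-(Module.finrank ℝ V : ℝ)) * g (Real.log ‖x‖) * v (‖x‖⁻¹ • x) ∂μ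
      = (∫ s, g s) * ∫ θ : Metric.sphere (0 : V) 1, v θ ∂μ.toSphere := by
  have hdim : Module.finrank ℝ V = Module.finrank ℝ V - 1 + 1 :=
    (Nat.sub_add_cancel Module.finrank_pos).symm
  rw [← measurePreserving_polarMap.integral_comp measurableEmbedding_polarMap]
  simp only [normalize_polarMap]
  simp only [norm_polarMap]
  rw [integral_prod_mul (fun r : Set.Ioi (0 : ℝ) =>
    (r : ℝ) ^ (-(Module.finrank ℝ V : ℝ)) * g (Real.log r))
    (fun θ : Metric.sphere (0 : V) 1 => v θ)]
  rw [← integral_volumeIoiPow_log (Module.finrank ℝ V - 1), ← hdim]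

theorem ae_normalize {P : V → Prop} (hP : ∀ᵐ θ : Metric.sphere (0 : V) 1 ∂μ.toSphere, P θ) :
    ∀ᵐ x ∂μ, P (‖x‖⁻¹ • x) := by
  rw [← (measurePreserving_polarMap (μ := μ)).map_eq, measurableEmbedding_polarMap.ae_map_iff]
  simp only [normalize_polarMap]
  exact Measure.quasiMeasurePreserving_snd.ae hP

theorem ae_ae_polarMap {P : V → Prop} (hP : ∀ᵐ x ∂μ, P x) :
    ∀ᵐ r ∂Measure.volumeIoiPow (Module.finrank ℝ V - 1), ∀ᵐ θ ∂μ.toSphere, P (polarMap (r, θ)) :=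
  Measure.ae_ae_of_ae_prod (measurePreserving_polarMap.quasiMeasurePreserving.ae hP)

theorem ae_integrable_polarMap {f : V → ℝ} (hf : LocallyIntegrableOn f {0}ᶜ μ) :
    ∀ᵐ r ∂Measure.volumeIoiPow (Module.finrank ℝ V - 1),
      Integrable (fun θ => f (polarMap (r, θ))) μ.toSphere := by
  let K (k : ℕ) : Set V := Metric.closedBall 0 (k + 1) \ Metric.ball 0 ((k : ℝ) + 1)⁻¹
  have hKcompact (k : ℕ) : IsCompact (K k) :=
    (isCompact_closedBall _ _).diff Metric.isOpen_ball
  have hK (k : ℕ) : K k ⊆ {0}ᶜ := by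
    rintro x hx (rfl : x = 0)
    exact hx.2 (Metric.mem_ball_self (by positivity))
  have hint (k : ℕ) : Integrable ((K k).indicator f) μ :=
    (integrable_indicator_iff (hKcompact k).measurableSet).mpr
      (hf.integrableOn_compact_subset (hK k) (hKcompact k))
  have hslice (k : ℕ) := ((measurePreserving_polarMap (μ := μ)).integrable_comp
    (hint k).1 |>.mpr (hint k)).prod_right_ae
  filter_upwards [ae_all_iff.mpr hslice] with r hr
  obtain ⟨k, hk⟩ := exists_nat_ge (max (r : ℝ) (r : ℝ)⁻¹)
  have hmem (θ : Metric.sphere (0 : V) 1) : polarMap (r, θ) ∈ K k := by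
    have hr₀ : (0 : ℝ) < r := r.2
    simp only [K, Set.mem_sdiff, mem_closedBall_zero_iff, mem_ball_zero_iff, norm_polarMap, not_lt]
    exact ⟨by linarith [le_max_left (r : ℝ) (r : ℝ)⁻¹],
      inv_le_of_inv_le₀ hr₀ (by linarith [le_max_right (r : ℝ) (r : ℝ)⁻¹])⟩
  simpa only [Function.comp_apply, Set.indicator_of_mem (hmem _)] using hr k

namespace IsHomogeneousAE

variable {u w : V → ℝ} {b : ℝ}

theorem mul {v f : V → ℝ} {c : ℝ} (hu : IsHomogeneousAE μ b w u) (hf : IsHomogeneousAE μ c v f) :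
    IsHomogeneousAE μ (b + c) (fun x => w x * v x) fun x => u x * f x := by
  filter_upwards [hu, hf, Measure.ae_ne μ 0] with x hux hfx hx
  rw [hux, hfx, Real.rpow_add (norm_pos_iff.mpr hx)]
  ring

theorem ae_eq_zero (hu : IsHomogeneousAE μ b w u)
    (hw : ∀ᵐ θ : Metric.sphere (0 : V) 1 ∂μ.toSphere, w θ = 0) : ∀ᵐ x ∂μ, u x = 0 := by
  filter_upwards [hu, ae_normalize (P := fun y => w y = 0) hw] with x hux hwx
  rw [hux, hwx, mul_zero]

theorem integral_mul_radial (hu : IsHomogeneousAE μ b w u) {a : ℝ}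
    (hab : b + a = -Module.finrank ℝ V) (g : ℝ → ℝ) :
    ∫ x, u x * (‖x‖ ^ a * g (Real.log ‖x‖)) ∂μ
      = (∫ s, g s) * ∫ θ : Metric.sphere (0 : V) 1, w θ ∂μ.toSphere := by
  rw [← integral_polar g w, ← hab]
  refine integral_congr_ae ?_
  filter_upwards [hu, Measure.ae_ne μ 0] with x hux hx
  rw [hux, Real.rpow_add (norm_pos_iff.mpr hx)]
  ring

theorem integrable_angular (hf : LocallyIntegrableOn u {0}ᶜ μ) (hhom : IsHomogeneousAE μ b w u) :
    Integrable (fun θ : Metric.sphere (0 : V) 1 => w θ) μ.toSphere := by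
  obtain ⟨r, hint, hr⟩ := ((ae_integrable_polarMap hf).and (ae_ae_polarMap hhom)).exists
  refine (hint.const_mul ((r : ℝ) ^ b)⁻¹).congr ?_
  filter_upwards [hr] with θ hθ
  rw [hθ, normalize_polarMap, norm_polarMap,
    inv_mul_cancel_left₀ (Real.rpow_pos_of_pos r.2 b).ne']

end IsHomogeneousAE

end Polar

/-! ### Integrals over the sphere -/

/-- The surface measure of the unit sphere of `ℝⁿ`. -/
abbrev sphereMeasure (n : ℕ) : Measure (Metric.sphere (0 : E n) 1) :=
  (volume : Measure (E n)).toSphere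

theorem HomZero.continuous_sphere (q : HomZero n) :
    Continuous fun θ : Metric.sphere (0 : E n) 1 => q θ :=
  q.2.1.continuousOn.comp_continuous continuous_subtype_val fun θ => by
    simpa using ne_zero_of_mem_unit_sphere θ

theorem integrable_sphere_of_continuous {f : Metric.sphere (0 : E n) 1 → ℝ} (hf : Continuous f) :
    Integrable f (sphereMeasure n) :=
  hf.integrable_of_hasCompactSupport (HasCompactSupport.of_compactSpace f)

theorem integrable_sphere_mul_continuous {f g : Metric.sphere (0 : E n) 1 → ℝ}
    (hf : Integrable f (sphereMeasure n)) (hg : Continuous g) :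
    Integrable (fun θ => f θ * g θ) (sphereMeasure n) := by
  obtain ⟨C, hC⟩ := isCompact_univ.exists_bound_of_continuousOn hg.continuousOn
  exact hf.mul_bdd hg.aestronglyMeasurable (.of_forall fun θ => hC θ (Set.mem_univ θ))

theorem HomZero.isHomogeneousAE (q : HomZero n) : IsHomogeneousAE volume 0 q q :=
  .of_forall fun x => by rw [Real.rpow_zero, one_mul, apply_normalize]

/-- The functional `q ↦ ∫ w q` on the sphere. -/
def moment {w : E n → ℝ}
    (hw : Integrable (fun θ : Metric.sphere (0 : E n) 1 => w θ) (sphereMeasure n)) :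
    HomZero n →ₗ[ℝ] ℝ where
  toFun q := ∫ θ : Metric.sphere (0 : E n) 1, w θ * q θ ∂sphereMeasure n
  map_add' q r := by
    rw [← integral_add (integrable_sphere_mul_continuous hw (continuous_sphere q))
      (integrable_sphere_mul_continuous hw (continuous_sphere r))]
    simp only [AddMemClass.coe_add, Pi.add_apply, mul_add]
  map_smul' c q := by
    rw [RingHom.id_apply, smul_eq_mul, ← integral_const_mul]
    simp only [SetLike.val_smul, Pi.smul_apply, smul_eq_mul, mul_left_comm]

/-- The `L²` inner product of the sphere. -/
def ip (q : HomZero n) : HomZero n →ₗ[ℝ] ℝ :=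
  moment (integrable_sphere_of_continuous (continuous_sphere q))

theorem ip_comm (q r : HomZero n) : ip q r = ip r q := by
  simp only [ip, moment, LinearMap.coe_mk, AddHom.coe_mk, mul_comm]

theorem ip_self_nonneg (q : HomZero n) : 0 ≤ ip q q := integral_nonneg fun _ => mul_self_nonneg _

section

variable [NeZero n]

theorem integral_mul_sep {u w : E n → ℝ} {b a : ℝ} (hu : IsHomogeneousAE volume b w u)
    (hab : b + a = -n) (η : Profile) (q : HomZero n) :
    ∫ x, u x * sep a η q x
      = (∫ s, η s) * ∫ θ : Metric.sphere (0 : E n) 1, w θ * q θ ∂sphereMeasure n := by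
  have hpolar := (hu.mul (isHomogeneousAE q)).integral_mul_radial (a := a)
    (by rw [finrank_euclideanSpace_fin, add_zero, hab]) η
  refine Eq.trans (integral_congr_ae (.of_forall fun x => ?_)) hpolar
  simp only [sep_apply]
  ring

theorem integral_sep_mul_sep {a b : ℝ} (hab : a + b = -n) (η ζ : Profile) (q r : HomZero n) :
    ∫ x, sep a η q x * sep b ζ r x = (∫ s, η s * ζ s) * ip q r := by
  have hpolar := ((isHomogeneousAE q).mul (isHomogeneousAE r)).integral_mul_radial (a := a + b)
    (by rw [finrank_euclideanSpace_fin, add_zero, zero_add, hab]) fun s => η s * ζ s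
  refine Eq.trans (integral_congr_ae ?_) hpolar
  filter_upwards [Measure.ae_ne volume 0] with x hx
  rw [sep_apply, sep_apply, Real.rpow_add (norm_pos_iff.mpr hx)]
  ring

theorem Profile.integral_aeval (P : ℝ[X]) (η : Profile) :
    ∫ s, aeval der P η s = P.eval 0 * ∫ s, η s := by
  have hdivX : aeval der P η = der (aeval der P.divX η) + P.eval 0 • η := by
    conv_lhs => rw [← P.X_mul_divX_add]
    simp [coeff_zero_eq_eval_zero]
  simp only [hdivX, Submodule.coe_add, Submodule.coe_smul, Pi.add_apply, Pi.smul_apply,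
    smul_eq_mul]
  rw [integral_add (integrable _) ((integrable η).const_mul _), integral_der, zero_add,
    integral_const_mul]

theorem integral_mul_sepAeval {u w : E n → ℝ} {b a : ℝ} (hu : IsHomogeneousAE volume b w u)
    (huloc : LocallyIntegrableOn u {0}ᶜ volume)
    (hw : Integrable (fun θ : Metric.sphere (0 : E n) 1 => w θ) (sphereMeasure n))
    (hab : b + a = -n) (η : Profile) (q : HomZero n) (P : ℝ[X][X]) :
    ∫ x, u x * sepAeval a η q P x
      = (∫ s, η s) * moment hw (aeval negLap (P.map (evalRingHom 0)) q) := by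
  induction P using Polynomial.induction_on' with
  | add P Q hP hQ =>
    simp only [map_add, Pi.add_apply, mul_add, Polynomial.map_add, LinearMap.add_apply]
    rw [integral_add ((isTestFunction_sepAeval a η q P).integrable_mul huloc)
      ((isTestFunction_sepAeval a η q Q).integrable_mul huloc), hP, hQ]
  | monomial j c =>
    rw [sepAeval_monomial, integral_mul_sep hu hab, integral_aeval, map_monomial,
      aeval_monomial, Module.End.mul_apply, Module.algebraMap_end_apply, map_smul, smul_eq_mul,
      coe_evalRingHom, mul_comm (c.eval 0), mul_assoc]
    rfl

/-- The equation tested with the separated functions of the degree for which the radial integral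
factors off. -/
theorem IsDistributionalSolution.moment_eq {p k : ℝ} (hk : k * (p - 1) = 6) {u w : E n → ℝ}
    (hu : IsHomogeneousAE volume (-k) w u) (huloc : LocallyIntegrableOn u {0}ᶜ volume)
    (hw : Integrable (fun θ : Metric.sphere (0 : E n) 1 => w θ) (sphereMeasure n))
    (hsol : IsDistributionalSolution {0}ᶜ p u) (q : HomZero n) :
    ∫ θ : Metric.sphere (0 : E n) 1, |w θ| ^ (p - 1) * w θ * q θ ∂sphereMeasure n
      = moment hw (aeval negLap (angularSymbol n k) q) := by
  obtain ⟨η, hη⟩ : ∃ η : Profile, 0 < ∫ s, η s := by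
    let b : ContDiffBump (0 : ℝ) := default
    exact ⟨⟨b, b.contDiff, b.hasCompactSupport⟩, b.integral_pos⟩
  have hleft := integral_mul_sep ((hu.abs_rpow (p - 1)).mul hu) (a := k + 6 - n)
    (by linarith) η q
  have hright := integral_mul_sepAeval hu huloc hw (a := k + 6 - n - 6) (by ring) η q
    (triharmonicSymbol n (k + 6 - n))
  rw [hsol _ (isTestFunction_sep _ η q), laplacian_cubed_sep, hright,
    triharmonicSymbol_map_eval_zero, map_neg, LinearMap.neg_apply, map_neg, mul_neg,
    neg_neg] at hleft
  exact (mul_left_cancel₀ hη.ne' hleft).symm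

/-! ### Stability on the sphere -/

namespace Profile

theorem integrable_mul (η ζ : Profile) : Integrable fun s => η s * ζ s :=
  ((continuous η).mul (continuous ζ)).integrable_of_hasCompactSupport
    (hasCompactSupport ζ).mul_left

theorem exists_integral_mul_self_pos : ∃ η : Profile, 0 < ∫ s, η s * η s := by
  let b : ContDiffBump (0 : ℝ) := default
  refine ⟨⟨b, b.contDiff, b.hasCompactSupport⟩, ?_⟩
  refine (b.continuous.mul b.continuous).integral_pos_of_hasCompactSupport_nonneg_nonzero
    (b.hasCompactSupport.mul_left) (fun x => mul_self_nonneg _) (x := 0) ?_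
  simp [b.one_of_mem_closedBall (Metric.mem_closedBall_self b.rIn_pos.le)]

/-- The profile `η` stretched by the factor `m + 1`. As `m → ∞` its derivatives become negligible,
as for the cutoffs that saturate Hardy's inequality. -/
def stretch (m : ℕ) (η : Profile) : Profile :=
  ⟨fun s => η (((m : ℝ) + 1)⁻¹ * s), (contDiff η).comp (contDiff_const.mul contDiff_id),
    (hasCompactSupport η).comp_homeomorph (Homeomorph.mulLeft₀ _ (by positivity))⟩

theorem stretch_apply (m : ℕ) (η : Profile) (s : ℝ) :
    stretch m η s = η (((m : ℝ) + 1)⁻¹ * s) := rfl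

theorem der_pow_stretch (m : ℕ) (η : Profile) (i : ℕ) :
    (der ^ i) (stretch m η) = ((m : ℝ) + 1)⁻¹ ^ i • stretch m ((der ^ i) η) := by
  have hder (ζ : Profile) : der (stretch m ζ) = ((m : ℝ) + 1)⁻¹ • stretch m (der ζ) := by
    ext s
    have hchain : HasDerivAt (stretch m ζ) (der ζ (((m : ℝ) + 1)⁻¹ * s) * ((m : ℝ) + 1)⁻¹) s :=
      (hasDerivAt ζ _).comp s (hasDerivAt_const_mul _)
    exact hchain.deriv.trans (mul_comm _ _)
  induction i with
  | zero => simp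
  | succ i ih =>
    rw [pow_succ', Module.End.mul_apply, ih, map_smul, hder, smul_smul, pow_succ,
      Module.End.mul_apply]

theorem integral_stretch_mul_stretch (m : ℕ) (η ζ : Profile) :
    ((m : ℝ) + 1)⁻¹ * ∫ s, stretch m η s * stretch m ζ s = ∫ s, η s * ζ s := by
  have hm : (0 : ℝ) < ((m : ℝ) + 1)⁻¹ := by positivity
  simp only [stretch_apply]
  rw [Measure.integral_comp_mul_left (fun s => η s * ζ s), abs_of_pos (inv_pos.mpr hm),
    smul_eq_mul, mul_inv_cancel_left₀ hm.ne']

open Filter Topology in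
theorem tendsto_integral_stretch_mul_aeval (η : Profile) (P : ℝ[X]) :
    Tendsto (fun m : ℕ => ((m : ℝ) + 1)⁻¹ * ∫ s, stretch m η s * aeval der P (stretch m η) s)
      atTop (𝓝 (P.eval 0 * ∫ s, η s * η s)) := by
  induction P using Polynomial.induction_on' with
  | add P Q hP hQ =>
    refine (eval_add (p := P) (q := Q) (x := (0 : ℝ)) ▸ add_mul (P.eval 0) _ _ ▸
      hP.add hQ).congr fun m => ?_
    rw [← mul_add, ← integral_add (integrable_mul _ _) (integrable_mul _ _)]
    simp only [map_add, LinearMap.add_apply, Submodule.coe_add, Pi.add_apply, mul_add]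
  | monomial i c =>
    have hstretch (m : ℕ) :
        ((m : ℝ) + 1)⁻¹ * ∫ s, stretch m η s * aeval der (monomial i c) (stretch m η) s
          = c * ((m : ℝ) + 1)⁻¹ ^ i * ∫ s, η s * (der ^ i) η s := by
      rw [← integral_stretch_mul_stretch m η, mul_left_comm, ← integral_const_mul (c * _)]
      simp only [aeval_monomial, Module.End.mul_apply, Module.algebraMap_end_apply,
        der_pow_stretch, Submodule.coe_smul, Pi.smul_apply, smul_eq_mul]
      congr 2 with s
      ring
    have hinv : Tendsto (fun m : ℕ => ((m : ℝ) + 1)⁻¹) atTop (𝓝 0) := by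
      simpa only [one_div] using tendsto_one_div_add_atTop_nhds_zero_nat (𝕜 := ℝ)
    have hlim : Tendsto (fun m : ℕ => c * ((m : ℝ) + 1)⁻¹ ^ i * ∫ s, η s * (der ^ i) η s) atTop
        (𝓝 (c * 0 ^ i * ∫ s, η s * (der ^ i) η s)) := ((hinv.pow i).const_mul c).mul_const _
    simp only [hstretch]
    rcases eq_or_ne i 0 with rfl | hi
    · simp
    · simpa [hi] using hlim

end Profile

open Filter Topology in
theorem tendsto_integral_sep_mul_sepAeval {a b : ℝ} (hab : a + b = -n) (η : Profile)
    (q : HomZero n) (P : ℝ[X][X]) :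
    Tendsto (fun m : ℕ => ((m : ℝ) + 1)⁻¹ *
        ∫ x, sep a (stretch m η) q x * sepAeval b (stretch m η) q P x)
      atTop (𝓝 ((∫ s, η s * η s) * ip q (aeval negLap (P.map (evalRingHom 0)) q))) := by
  induction P using Polynomial.induction_on' with
  | add P Q hP hQ =>
    rw [Polynomial.map_add, map_add, LinearMap.add_apply, map_add, mul_add]
    refine (hP.add hQ).congr fun m => ?_
    have hint (R : ℝ[X][X]) : Integrable fun x =>
        sep a (stretch m η) q x * sepAeval b (stretch m η) q R x :=
      (isTestFunction_sepAeval b (stretch m η) q R).integrable_continuous_mul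
        (contDiff_sep a (stretch m η) q).continuous
    rw [← mul_add, ← integral_add (hint P) (hint Q)]
    simp only [map_add, Pi.add_apply, mul_add]
  | monomial j c =>
    rw [map_monomial, aeval_monomial, Module.End.mul_apply, Module.algebraMap_end_apply, map_smul,
      smul_eq_mul, coe_evalRingHom, mul_left_comm, ← mul_assoc]
    refine ((tendsto_integral_stretch_mul_aeval η c).mul_const _).congr fun m => ?_
    rw [sepAeval_monomial, integral_sep_mul_sep hab, mul_assoc]

/-- The degree `3 - n/2` makes `|∇Δφ|²` homogeneous of degree `-n`, as in Hardy's inequality. -/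
theorem IsStable.integral_le {p k : ℝ} (hk : k * (p - 1) = 6) {u w : E n → ℝ}
    (hu : IsHomogeneousAE volume (-k) w u) (hstab : IsStable {0}ᶜ p u) (q : HomZero n) :
    p * ∫ θ : Metric.sphere (0 : E n) 1, |w θ| ^ (p - 1) * q θ ^ 2 ∂sphereMeasure n
      ≤ ip q (aeval negLap (angularSymbol n (n / 2 - 3)) q) := by
  obtain ⟨η, hη⟩ := exists_integral_mul_self_pos
  let a : ℝ := n / 2 - 3 + 6 - n
  have hleft (ζ : Profile) : ∫ x, |u x| ^ (p - 1) * sep a ζ q x ^ 2 = (∫ s, ζ s * ζ s) *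
      ∫ θ : Metric.sphere (0 : E n) 1, |w θ| ^ (p - 1) * q θ ^ 2 ∂sphereMeasure n := by
    have hpolar := (((hu.abs_rpow (p - 1)).mul (isHomogeneousAE q)).mul
      (isHomogeneousAE q)).integral_mul_radial (a := a * (2 : ℕ))
      (by rw [finrank_euclideanSpace_fin]; push_cast; linear_combination -hk)
      fun s => ζ s * ζ s
    calc ∫ x, |u x| ^ (p - 1) * sep a ζ q x ^ 2
        = ∫ x, |u x| ^ (p - 1) * q x * q x
            * (‖x‖ ^ (a * (2 : ℕ)) * (ζ (Real.log ‖x‖) * ζ (Real.log ‖x‖))) := by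
          refine integral_congr_ae (.of_forall fun x => ?_)
          simp only [sep_apply, Real.rpow_mul_natCast (norm_nonneg x)]
          ring
      _ = _ := by rw [hpolar]; simp only [mul_assoc, sq]
  have hright (m : ℕ) : p * ((∫ s, η s * η s) *
      ∫ θ : Metric.sphere (0 : E n) 1, |w θ| ^ (p - 1) * q θ ^ 2 ∂sphereMeasure n) ≤
      ((m : ℝ) + 1)⁻¹ * ∫ x, sep a (stretch m η) q x *
        sepAeval (a - 6) (stretch m η) q (-triharmonicSymbol n a) x := by
    have htest := isTestFunction_sep a (stretch m η) q
    have hm := mul_le_mul_of_nonneg_left (hstab _ htest) (by positivity : 0 ≤ ((m : ℝ) + 1)⁻¹)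
    rw [hleft, integral_norm_gradient_laplacian_sq htest, laplacian_cubed_sep, ← integral_neg,
      mul_left_comm, ← mul_assoc _ (∫ s, _), integral_stretch_mul_stretch] at hm
    simpa only [map_neg, Pi.neg_apply, mul_neg] using hm
  have hlim := ge_of_tendsto' (tendsto_integral_sep_mul_sepAeval (a := a) (b := a - 6)
    (by ring) η q (-triharmonicSymbol n a)) hright
  rw [Polynomial.map_neg, triharmonicSymbol_map_eval_zero, neg_neg, mul_left_comm] at hlim
  exact le_of_mul_le_mul_left hlim hη

/-! ### Positivity of the Laplacian of the sphere -/

theorem ip_negLap (q r : HomZero n) : ip (negLap q) r = ip q (negLap r) := by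
  obtain ⟨η, hη⟩ := exists_integral_mul_self_pos
  let a : ℝ := 1 - n / 2
  have hsum : a + (a - 2) = -n := by ring
  have hsum' : a - 2 + a = -n := by ring
  have hint (b c : ℝ) (ζ ξ : Profile) (q r : HomZero n) :
      Integrable fun x => sep b ζ q x * sep c ξ r x :=
    (isTestFunction_sep c ξ r).integrable_continuous_mul (contDiff_sep b ζ q).continuous
  have hgreen := integral_laplacian_mul (isTestFunction_sep a η q) (isTestFunction_sep a η r)
  simp only [laplacian_sep, Pi.sub_apply, sub_mul, mul_sub] at hgreen
  rw [integral_sub (hint _ _ _ _ _ _) (hint _ _ _ _ _ _),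
    integral_sub (hint _ _ _ _ _ _) (hint _ _ _ _ _ _), integral_sep_mul_sep hsum',
    integral_sep_mul_sep hsum', integral_sep_mul_sep hsum, integral_sep_mul_sep hsum] at hgreen
  simp only [mul_comm (aeval der (radialSymbol n a) η _)] at hgreen
  exact mul_left_cancel₀ hη.ne' (sub_right_injective hgreen)

theorem ip_negLap_self_nonneg (q : HomZero n) : 0 ≤ ip q (negLap q) := by
  have hzero : ip (unit n) (negLap (q * q)) = 0 := by
    rw [← ip_negLap, negLap_apply]
    simp only [ang_unit, map_zero, Finset.sum_const_zero, neg_zero, ip_comm 0]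
  have hunit (f g : HomZero n) : ip (unit n) (f * g) = ip f g := by
    refine integral_congr_ae (.of_forall fun θ => ?_)
    simp only [unit_apply (ne_zero_of_mem_unit_sphere θ), one_mul, MulMemClass.coe_mul,
      Pi.mul_apply]
  rw [negLap_mul, map_sub, map_add, map_smul, map_sum, smul_eq_mul] at hzero
  simp only [hunit] at hzero
  have hgrad : 0 ≤ ∑ i, ip (ang i q) (ang i q) := Finset.sum_nonneg fun i _ => ip_self_nonneg _
  linarith

theorem ip_negLap_pow_self_nonneg (i : ℕ) (q : HomZero n) : 0 ≤ ip q ((negLap ^ i) q) := by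
  induction i using Nat.twoStepInduction generalizing q with
  | zero => exact ip_self_nonneg q
  | one => exact ip_negLap_self_nonneg q
  | more i ih _ =>
    rw [pow_succ', Module.End.mul_apply, ← ip_negLap, pow_succ, Module.End.mul_apply]
    exact ih (negLap q)

theorem ip_aeval_negLap_self_nonneg {P : ℝ[X]} (hP : ∀ i, 0 ≤ P.coeff i) (q : HomZero n) :
    0 ≤ ip q (aeval negLap P q) := by
  rw [aeval_eq_sum_range, LinearMap.sum_apply, map_sum]
  refine Finset.sum_nonneg fun i _ => ?_
  rw [LinearMap.smul_apply, map_smul, smul_eq_mul]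
  exact mul_nonneg (hP i) (ip_negLap_pow_self_nonneg i q)

end

/-! ### Projections onto polynomials -/

namespace HomZero

/-- The restrictions to the sphere of polynomials of degree at most `m`, that is, the polynomials
of degree at most `m` in the coordinates `xᵢ / ‖x‖`. -/
def spherePoly (n : ℕ) : ℕ → Submodule ℝ (HomZero n)
  | 0 => Submodule.span ℝ {unit n}
  | m + 1 => spherePoly n m ⊔ ⨆ i, (spherePoly n m).map (LinearMap.mulLeft ℝ (coord i))

theorem spherePoly_mono : Monotone (spherePoly n) := monotone_nat_of_le_succ fun _ => le_sup_left

instance (m : ℕ) : FiniteDimensional ℝ (spherePoly n m) := by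
  induction m with
  | zero => exact FiniteDimensional.span_singleton ℝ _
  | succ m ih => rw [spherePoly]; infer_instance

theorem coord_mul_mem_spherePoly {m : ℕ} (i : Fin n) {q : HomZero n} (hq : q ∈ spherePoly n m) :
    coord i * q ∈ spherePoly n (m + 1) :=
  Submodule.mem_sup_right (Submodule.mem_iSup_of_mem i ⟨q, hq, rfl⟩)

theorem spherePoly_succ_le {m : ℕ} {W : Submodule ℝ (HomZero n)} (hW : spherePoly n m ≤ W)
    (hcoord : ∀ i, ∀ q ∈ spherePoly n m, coord i * q ∈ W) : spherePoly n (m + 1) ≤ W :=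
  sup_le hW (iSup_le fun i => Submodule.map_le_iff_le_comap.mpr (hcoord i))

theorem ite_unit_mul (P : Prop) [Decidable P] (q : HomZero n) :
    (if P then unit n else 0) * q = if P then q else 0 := by
  rw [ite_mul, unit_mul, zero_mul]

theorem ang_mem_spherePoly (i : Fin n) (m : ℕ) :
    spherePoly n m ≤ (spherePoly n (m + 1)).comap (ang i) := by
  induction m with
  | zero =>
    refine (Submodule.span_singleton_le_iff_mem _ _).mpr ?_
    rw [Submodule.mem_comap, ang_unit]
    exact zero_mem _
  | succ m ih =>
    refine spherePoly_succ_le (ih.trans (Submodule.comap_mono (spherePoly_mono (Nat.le_succ _))))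
      fun j q hq => ?_
    rw [Submodule.mem_comap, ang_mul, ang_coord, mul_comm q, sub_mul, ite_unit_mul, mul_assoc]
    refine add_mem (coord_mul_mem_spherePoly j (ih hq)) (sub_mem ?_
      (coord_mul_mem_spherePoly i (coord_mul_mem_spherePoly j hq)))
    split_ifs
    · exact spherePoly_mono (by lia) hq
    · exact zero_mem _

theorem negLap_coord (j : Fin n) : negLap (coord j) = ((n : ℝ) - 1) • coord j := by
  have hang (i : Fin n) : ang i (ang i (coord j))
      = coord j * (coord i * coord i) - coord j * unit n - coord i * ang i (coord j) := by
    have hdelta : ang i (if i = j then unit n else 0) = 0 := by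
      split_ifs
      · exact ang_unit i
      · exact map_zero _
    conv_lhs => rw [ang_coord, map_sub, hdelta, ang_mul, ang_coord i i, if_pos rfl, mul_sub]
    abel
  rw [negLap_apply]
  simp only [hang, Finset.sum_sub_distrib, sum_coord_mul_ang, ← Finset.mul_sum,
    sum_coord_mul_self, Finset.sum_const, Finset.card_univ, Fintype.card_fin]
  rw [mul_smul_comm, mul_comm, unit_mul, sub_zero, neg_sub, sub_smul, one_smul,
    Nat.cast_smul_eq_nsmul]

theorem sum_ang_coord_mul_ang (j : Fin n) (q : HomZero n) :
    ∑ i, ang i (coord j) * ang i q = ang j q := by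
  have hang (i : Fin n) : ang i (coord j) * ang i q
      = (if i = j then ang i q else 0) - coord j * (coord i * ang i q) := by
    rw [ang_coord, sub_mul, ite_unit_mul, mul_comm (coord i), mul_assoc]
  simp only [hang, Finset.sum_sub_distrib, ← Finset.mul_sum, sum_coord_mul_ang, mul_zero, sub_zero,
    Finset.sum_ite_eq', Finset.mem_univ, if_true]

theorem negLap_mem_spherePoly (m : ℕ) : spherePoly n m ≤ (spherePoly n m).comap negLap := by
  induction m with
  | zero =>
    refine (Submodule.span_singleton_le_iff_mem _ _).mpr ?_
    simp only [Submodule.mem_comap, negLap_apply, ang_unit, map_zero, Finset.sum_const_zero,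
      neg_zero, zero_mem]
  | succ m ih =>
    refine spherePoly_succ_le (ih.trans (Submodule.comap_mono (spherePoly_mono (Nat.le_succ _))))
      fun j q hq => ?_
    rw [Submodule.mem_comap, negLap_mul, sum_ang_coord_mul_ang, negLap_coord, mul_comm q,
      smul_mul_assoc]
    exact sub_mem (add_mem (coord_mul_mem_spherePoly j (ih hq))
      (Submodule.smul_mem _ _ (coord_mul_mem_spherePoly j hq)))
      (Submodule.smul_mem _ _ (ang_mem_spherePoly j m hq))

theorem aeval_negLap_mem_spherePoly {m : ℕ} {q : HomZero n} (hq : q ∈ spherePoly n m) (P : ℝ[X]) :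
    aeval negLap P q ∈ spherePoly n m := by
  have hpow (i : ℕ) : (negLap ^ i) q ∈ spherePoly n m := by
    rw [Module.End.pow_apply]
    exact (show Set.MapsTo negLap _ _ from negLap_mem_spherePoly m).iterate i hq
  rw [aeval_eq_sum_range, LinearMap.sum_apply]
  exact Submodule.sum_mem _ fun i _ => Submodule.smul_mem _ _ (hpow i)

/-- Restriction to the unit sphere. -/
def toSphere (n : ℕ) : HomZero n →ₗ[ℝ] C(Metric.sphere (0 : E n) 1, ℝ) where
  toFun q := ⟨fun θ => q θ, continuous_sphere q⟩
  map_add' _ _ := rfl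
  map_smul' _ _ := rfl

theorem adjoin_coord_le :
    (Algebra.adjoin ℝ (Set.range fun i => toSphere n (coord i))).toSubmodule
      ≤ ⨆ m, (spherePoly n m).map (toSphere n) := by
  rw [Algebra.adjoin_eq_span, Submodule.span_le]
  have hmono : Monotone fun m => (spherePoly n m).map (toSphere n) := fun _ _ h =>
    Submodule.map_mono (spherePoly_mono h)
  intro f hf
  induction hf using Submonoid.closure_induction_left with
  | one =>
    refine Submodule.mem_iSup_of_mem 0 ⟨unit n, Submodule.mem_span_singleton_self _, ?_⟩
    ext θ
    exact unit_apply (ne_zero_of_mem_unit_sphere θ)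
  | mul_left f hf g _ hg =>
    obtain ⟨i, rfl⟩ := hf
    rw [SetLike.mem_coe, Submodule.mem_iSup_of_directed _ hmono.directed_le] at hg
    obtain ⟨m, q, hq, rfl⟩ := hg
    exact Submodule.mem_iSup_of_mem (m + 1) ⟨coord i * q, coord_mul_mem_spherePoly i hq, rfl⟩

theorem adjoin_coord_separatesPoints :
    (Algebra.adjoin ℝ (Set.range fun i => toSphere n (coord i))).SeparatesPoints := by
  intro θ θ' h
  obtain ⟨i, hi⟩ : ∃ i, (θ : E n) i ≠ (θ' : E n) i := by
    by_contra! hc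
    exact h (Subtype.ext (PiLp.ext hc))
  refine ⟨_, ⟨_, Algebra.subset_adjoin ⟨i, rfl⟩, rfl⟩, ?_⟩
  change coord i θ ≠ coord i θ'
  rwa [coord_apply, coord_apply, norm_eq_of_mem_sphere θ, norm_eq_of_mem_sphere θ', div_one,
    div_one]

/-- The class in `L²` of the sphere of a homogeneous function. -/
def toL2 (n : ℕ) : HomZero n →ₗ[ℝ] Lp ℝ 2 (sphereMeasure n) :=
  (ContinuousMap.toLp 2 (sphereMeasure n) ℝ).toLinearMap ∘ₗ toSphere n

theorem coeFn_toL2 (q : HomZero n) : toL2 n q =ᵐ[sphereMeasure n] fun θ => q θ :=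
  ContinuousMap.coeFn_toLp (sphereMeasure n) (toSphere n q)

theorem inner_toL2 {w : E n → ℝ}
    (hw : MemLp (fun θ : Metric.sphere (0 : E n) 1 => w θ) 2 (sphereMeasure n)) (q : HomZero n) :
    ⟪toL2 n q, hw.toLp⟫ = moment (hw.integrable one_le_two) q := by
  refine integral_congr_ae ?_
  filter_upwards [coeFn_toL2 q, hw.coeFn_toLp] with θ hq hwθ
  rw [hq, hwθ]
  rfl

theorem inner_toL2_toL2 (q r : HomZero n) : ⟪toL2 n r, toL2 n q⟫ = ip q r :=
  ContinuousMap.inner_toLp (sphereMeasure n) (toSphere n r) (toSphere n q)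

theorem iSup_map_toL2_dense : ⊤ ≤ (⨆ m, (spherePoly n m).map (toL2 n)).topologicalClosure := by
  rw [top_le_iff, ← Submodule.dense_iff_topologicalClosure_eq_top]
  have hadjoin : Dense (Algebra.adjoin ℝ (Set.range fun i => toSphere n (coord i)) :
      Set C(Metric.sphere (0 : E n) 1, ℝ)) := by
    rw [dense_iff_closure_eq, ← Subalgebra.topologicalClosure_coe,
      ContinuousMap.subalgebra_topologicalClosure_eq_top_of_separatesPoints _
        adjoin_coord_separatesPoints, Algebra.coe_top]
  refine ((ContinuousMap.toLp_denseRange ℝ (sphereMeasure n) ℝ (p := 2) (by simp)).dense_image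
    (ContinuousLinearMap.continuous _) hadjoin).mono ?_
  rintro _ ⟨f, hf, rfl⟩
  have hmap := Submodule.mem_map_of_mem
    (f := (ContinuousMap.toLp 2 (sphereMeasure n) ℝ).toLinearMap) (adjoin_coord_le hf)
  rw [Submodule.map_iSup] at hmap
  simp only [← Submodule.map_comp] at hmap
  exact hmap

open Filter Topology in
theorem exists_seq_moment_eq_ip {w : E n → ℝ}
    (hw : MemLp (fun θ : Metric.sphere (0 : E n) 1 => w θ) 2 (sphereMeasure n)) :
    ∃ ψ : ℕ → HomZero n,
      (∀ m (P : ℝ[X]), moment (hw.integrable one_le_two) (aeval negLap P (ψ m))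
        = ip (ψ m) (aeval negLap P (ψ m))) ∧
      ∀ᵐ θ : Metric.sphere (0 : E n) 1 ∂sphereMeasure n,
        Tendsto (fun m => ψ m θ) atTop (𝓝 (w θ)) := by
  let U (m : ℕ) : Submodule ℝ (Lp ℝ 2 (sphereMeasure n)) := (spherePoly n m).map (toL2 n)
  have hU : Monotone U := fun _ _ h => Submodule.map_mono (spherePoly_mono h)
  have : ∀ m, FiniteDimensional ℝ (U m) := fun m =>
    inferInstanceAs (FiniteDimensional ℝ ((spherePoly n m).map (toL2 n)))
  choose ψ hψ hproj using fun m => Submodule.starProjection_apply_mem (U m) hw.toLp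
  have hlim := Submodule.starProjection_tendsto_self U hU hw.toLp iSup_map_toL2_dense
  obtain ⟨ns, -, hns⟩ := (tendstoInMeasure_of_tendsto_Lp hlim).exists_seq_tendsto_ae
  refine ⟨fun m => ψ (ns m), fun m P => ?_, ?_⟩
  · rw [← inner_toL2, ← inner_toL2_toL2, hproj, ← sub_eq_zero, ← inner_sub_right]
    exact Submodule.sub_starProjection_mem_orthogonal (K := U (ns m)) _ _
      ⟨_, aeval_negLap_mem_spherePoly (hψ (ns m)) P, rfl⟩
  · filter_upwards [ae_all_iff.mpr fun m => coeFn_toL2 (ψ (ns m)), hns, hw.coeFn_toLp]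
      with θ hcoe hlimθ hwθ
    simpa only [← hproj, hcoe, hwθ] using hlimθ

end HomZero

/-! ### The comparison on the sphere -/

section Powers

theorem abs_rpow_sub_one_mul_sq {p : ℝ} (hp : p + 1 ≠ 0) (y : ℝ) :
    |y| ^ (p - 1) * y ^ 2 = |y| ^ (p + 1) := by
  have hsum : p - 1 + 2 = p + 1 := by ring
  rw [← hsum, Real.rpow_add' (abs_nonneg y) (by rwa [hsum]), Real.rpow_two, sq_abs]

theorem rpow_le_one_add_rpow {y a b : ℝ} (hy : 0 ≤ y) (ha : 0 ≤ a) (hab : a ≤ b) :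
    y ^ a ≤ 1 + y ^ b := by
  rcases le_total y 1 with hle | hle
  · linarith [Real.rpow_le_one hy hle ha, Real.rpow_nonneg hy b]
  · linarith [Real.rpow_le_rpow_of_exponent_le hle hab]

variable {α : Type*} [MeasurableSpace α] {μ : Measure α} {w f : α → ℝ} {p : ℝ}

theorem integrable_abs_rpow [IsFiniteMeasure μ] {a b : ℝ} (hw : AEStronglyMeasurable w μ)
    (ha : 0 ≤ a) (hab : a ≤ b) (hb : Integrable (fun x => |w x| ^ b) μ) :
    Integrable (fun x => |w x| ^ a) μ := by
  refine ((integrable_const (1 : ℝ)).add hb).mono'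
    (hw.aemeasurable.abs.pow_const a).aestronglyMeasurable (.of_forall fun x => ?_)
  rw [Real.norm_of_nonneg (Real.rpow_nonneg (abs_nonneg _) _)]
  exact rpow_le_one_add_rpow (abs_nonneg _) ha hab

theorem integrable_abs_rpow_sub_one_mul [IsFiniteMeasure μ] (hp : 0 < p)
    (hw : AEStronglyMeasurable w μ) (hint : Integrable (fun x => |w x| ^ (p + 1)) μ) :
    Integrable (fun x => |w x| ^ (p - 1) * w x) μ := by
  have hmeas : AEStronglyMeasurable (fun x => |w x| ^ (p - 1)) μ :=
    (hw.aemeasurable.abs.pow_const _).aestronglyMeasurable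
  refine (integrable_abs_rpow hw hp.le (by linarith) hint).mono (hmeas.mul hw)
    (.of_forall fun x => le_of_eq ?_)
  rw [norm_mul, Real.norm_of_nonneg (Real.rpow_nonneg (abs_nonneg _) _), Real.norm_eq_abs,
    Real.norm_of_nonneg (Real.rpow_nonneg (abs_nonneg _) _)]
  nth_rw 2 [← Real.rpow_one |w x|]
  rw [← Real.rpow_add' (abs_nonneg _) (by simpa using hp.ne'), sub_add_cancel]

theorem two_mul_integral_abs_rpow_le (hp : p + 1 ≠ 0)
    (hw : Integrable (fun x => |w x| ^ (p + 1)) μ)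
    (hwf : Integrable (fun x => |w x| ^ (p - 1) * w x * f x) μ)
    (hf : Integrable (fun x => |w x| ^ (p - 1) * f x ^ 2) μ) :
    2 * ∫ x, |w x| ^ (p - 1) * w x * f x ∂μ
      ≤ ∫ x, |w x| ^ (p + 1) ∂μ + ∫ x, |w x| ^ (p - 1) * f x ^ 2 ∂μ := by
  rw [← integral_const_mul, ← integral_add hw hf]
  refine integral_mono (hwf.const_mul 2) (hw.add hf) fun x => ?_
  have hsq := mul_nonneg (Real.rpow_nonneg (abs_nonneg (w x)) (p - 1)) (sq_nonneg (w x - f x))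
  simp only [← abs_rpow_sub_one_mul_sq hp]
  linarith

open Filter Topology in
theorem integral_le_of_tendsto_ae {g : ℕ → α → ℝ} {G : α → ℝ} {C : ℝ}
    (hint : ∀ m, Integrable (g m) μ) (hnonneg : ∀ m x, 0 ≤ g m x) (hC : ∀ m, ∫ x, g m x ∂μ ≤ C)
    (hlim : ∀ᵐ x ∂μ, Tendsto (fun m => g m x) atTop (𝓝 (G x))) : ∫ x, G x ∂μ ≤ C := by
  have hC₀ : 0 ≤ C := (integral_nonneg (hnonneg 0)).trans (hC 0)
  have hG : 0 ≤ᵐ[μ] G := by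
    filter_upwards [hlim] with x hx using ge_of_tendsto' hx fun m => hnonneg m x
  rw [integral_eq_lintegral_of_nonneg_ae hG
    (aestronglyMeasurable_of_tendsto_ae atTop (fun m => (hint m).1) hlim)]
  refine ENNReal.toReal_le_of_le_ofReal hC₀ ?_
  calc ∫⁻ x, ENNReal.ofReal (G x) ∂μ
      = ∫⁻ x, liminf (fun m => ENNReal.ofReal (g m x)) atTop ∂μ := by
        refine lintegral_congr_ae ?_
        filter_upwards [hlim] with x hx using (ENNReal.tendsto_ofReal hx).liminf_eq.symm
    _ ≤ liminf (fun m => ∫⁻ x, ENNReal.ofReal (g m x) ∂μ) atTop :=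
        lintegral_liminf_le' fun m => (hint m).1.aemeasurable.ennreal_ofReal
    _ ≤ ENNReal.ofReal C := by
        refine liminf_le_of_frequently_le' (.of_forall fun m => ?_)
        rw [← ofReal_integral_eq_lintegral_ofReal (hint m) (.of_forall (hnonneg m))]
        exact ENNReal.ofReal_le_ofReal (hC m)

end Powers

theorem ip_aeval_negLap_mono [NeZero n] {A B : ℝ[X]} (hAB : ∀ i, B.coeff i ≤ A.coeff i)
    (q : HomZero n) : ip q (aeval negLap B q) ≤ ip q (aeval negLap A q) := by
  have hdiff := ip_aeval_negLap_self_nonneg (P := A - B)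
    (fun i => by rw [coeff_sub]; exact sub_nonneg.mpr (hAB i)) q
  rwa [map_sub, LinearMap.sub_apply, map_sub, sub_nonneg] at hdiff

section

variable {w : E n → ℝ} {p κ : ℝ}

theorem integrable_abs_rpow_sub_one_mul_sq (hp : 1 < p)
    (hw : AEStronglyMeasurable (fun θ : Metric.sphere (0 : E n) 1 => w θ) (sphereMeasure n))
    (hwp : Integrable (fun θ : Metric.sphere (0 : E n) 1 => |w θ| ^ (p + 1)) (sphereMeasure n))
    (q : HomZero n) : Integrable (fun θ : Metric.sphere (0 : E n) 1 =>
      |w θ| ^ (p - 1) * q θ ^ 2) (sphereMeasure n) :=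
  integrable_sphere_mul_continuous (integrable_abs_rpow hw (by linarith) (by linarith) hwp)
    ((continuous_sphere q).pow 2)

variable [NeZero n]

theorem integral_abs_rpow_sub_one_mul_sq_le (hp : 1 < p) (hκ₀ : 0 < κ) (hκ₁ : κ < 1)
    {A B : ℝ[X]} (hAB : ∀ i, B.coeff i ≤ κ * (p * A.coeff i))
    (hw : AEStronglyMeasurable (fun θ : Metric.sphere (0 : E n) 1 => w θ) (sphereMeasure n))
    (hwp : Integrable (fun θ : Metric.sphere (0 : E n) 1 => |w θ| ^ (p + 1)) (sphereMeasure n))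
    {q : HomZero n}
    (heq : ∫ θ : Metric.sphere (0 : E n) 1,
      |w θ| ^ (p - 1) * w θ * q θ ∂sphereMeasure n = ip q (aeval negLap A q))
    (hstab : p * ∫ θ : Metric.sphere (0 : E n) 1,
      |w θ| ^ (p - 1) * q θ ^ 2 ∂sphereMeasure n ≤ ip q (aeval negLap B q)) :
    ∫ θ : Metric.sphere (0 : E n) 1, |w θ| ^ (p - 1) * q θ ^ 2 ∂sphereMeasure n
      ≤ κ / (2 - κ) * ∫ θ : Metric.sphere (0 : E n) 1, |w θ| ^ (p + 1) ∂sphereMeasure n := by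
  have hcompare : p * ∫ θ : Metric.sphere (0 : E n) 1, |w θ| ^ (p - 1) * q θ ^ 2
      ∂sphereMeasure n ≤ p * (κ * ∫ θ : Metric.sphere (0 : E n) 1,
        |w θ| ^ (p - 1) * w θ * q θ ∂sphereMeasure n) := by
    refine hstab.trans ((ip_aeval_negLap_mono (A := (κ * p) • A) (fun i => ?_) _).trans_eq ?_)
    · rw [coeff_smul, smul_eq_mul, mul_assoc]
      exact hAB i
    · rw [heq, map_smul, LinearMap.smul_apply, map_smul, smul_eq_mul]
      ring
  have hcompare' := le_of_mul_le_mul_left hcompare (by linarith)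
  have hamgm := mul_le_mul_of_nonneg_left (two_mul_integral_abs_rpow_le (by linarith) hwp
    (integrable_sphere_mul_continuous (integrable_abs_rpow_sub_one_mul (by linarith) hw hwp)
      (continuous_sphere q)) (integrable_abs_rpow_sub_one_mul_sq hp hw hwp q)) hκ₀.le
  rw [div_mul_eq_mul_div, le_div_iff₀ (by linarith)]
  linarith

open Filter Topology in
theorem angular_ae_eq_zero (hp : 1 < p) (hκ₀ : 0 < κ)
    (hκ₁ : κ < 1) {A B : ℝ[X]} (hAB : ∀ i, B.coeff i ≤ κ * (p * A.coeff i))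
    (hw : Integrable (fun θ : Metric.sphere (0 : E n) 1 => w θ) (sphereMeasure n))
    (hwp : Integrable (fun θ : Metric.sphere (0 : E n) 1 => |w θ| ^ (p + 1)) (sphereMeasure n))
    (heq : ∀ q : HomZero n, ∫ θ : Metric.sphere (0 : E n) 1,
      |w θ| ^ (p - 1) * w θ * q θ ∂sphereMeasure n = moment hw (aeval negLap A q))
    (hstab : ∀ q : HomZero n, p * ∫ θ : Metric.sphere (0 : E n) 1,
      |w θ| ^ (p - 1) * q θ ^ 2 ∂sphereMeasure n ≤ ip q (aeval negLap B q)) :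
    ∀ᵐ θ : Metric.sphere (0 : E n) 1 ∂sphereMeasure n, w θ = 0 := by
  have hw₂ : MemLp (fun θ : Metric.sphere (0 : E n) 1 => w θ) 2 (sphereMeasure n) := by
    have hsq := integrable_abs_rpow hw.1 zero_le_two (by linarith) hwp
    simp only [Real.rpow_two, sq_abs] at hsq
    exact (memLp_two_iff_integrable_sq hw.1).mpr hsq
  obtain ⟨ψ, hψ, hlim⟩ := exists_seq_moment_eq_ip hw₂
  set I := ∫ θ : Metric.sphere (0 : E n) 1, |w θ| ^ (p + 1) ∂sphereMeasure n
  have hbound (m : ℕ) : ∫ θ : Metric.sphere (0 : E n) 1, |w θ| ^ (p - 1) * ψ m θ ^ 2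
      ∂sphereMeasure n ≤ κ / (2 - κ) * I :=
    integral_abs_rpow_sub_one_mul_sq_le hp hκ₀ hκ₁ hAB hw.1 hwp ((heq _).trans (hψ m _))
      (hstab _)
  have hfatou : I ≤ κ / (2 - κ) * I := by
    refine integral_le_of_tendsto_ae (fun m => integrable_abs_rpow_sub_one_mul_sq hp hw.1 hwp (ψ m))
      (fun m θ => by positivity) hbound ?_
    filter_upwards [hlim] with θ hθ
    rw [← abs_rpow_sub_one_mul_sq (by linarith)]
    exact (hθ.pow 2).const_mul _
  have hzero : I ≤ 0 := by
    have hratio : κ / (2 - κ) < 1 := (div_lt_one (by linarith)).mpr (by linarith)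
    nlinarith
  have hnonneg (θ : Metric.sphere (0 : E n) 1) : 0 ≤ |w θ| ^ (p + 1) := by positivity
  filter_upwards [(integral_eq_zero_iff_of_nonneg hnonneg hwp).mp
    (hzero.antisymm (integral_nonneg hnonneg))] with θ hθ
  exact abs_eq_zero.mp ((Real.rpow_eq_zero (abs_nonneg _) (by linarith)).mp hθ)

end

theorem locallyIntegrableOn_of_abs_rpow {V : Type*} [TopologicalSpace V] [MeasurableSpace V]
    {μ : Measure V} [IsLocallyFiniteMeasure μ] {Ω : Set V} {u : V → ℝ} {b : ℝ} (hb : 1 ≤ b)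
    (hu : AEStronglyMeasurable u μ) (hint : LocallyIntegrableOn (fun x => |u x| ^ b) Ω μ) :
    LocallyIntegrableOn u Ω μ := by
  refine ((locallyIntegrableOn_const (1 : ℝ)).add hint).mono hu (.of_forall fun x => ?_)
  calc ‖u x‖ = |u x| ^ (1 : ℝ) := (Real.rpow_one _).symm
    _ ≤ 1 + |u x| ^ b := rpow_le_one_add_rpow (abs_nonneg _) zero_le_one hb
    _ ≤ _ := Real.le_norm_self _

end Triharmonic
end

open Triharmonic MeasureTheory in
theorem theorem4p1_general (n : ℕ) (hn : 7 ≤ n) (p : ℝ)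
    (hp : ((n : ℝ) + 6) / ((n : ℝ) - 6) < p)
    (hpc : (p : EReal) < josephLundgrenExponent n)
    (u : E n → ℝ)
    (hu : AEStronglyMeasurable u)
    (huL : LocallyIntegrableOn (fun x => |u x| ^ (p + 1)) ({0}ᶜ : Set (E n)) volume)
    (hhom : ∃ w : E n → ℝ, ∀ᵐ x : E n, u x = ‖x‖ ^ (-(6 / (p - 1))) * w (‖x‖⁻¹ • x))
    (hsol : IsDistributionalSolution ({0}ᶜ : Set (E n)) p u)
    (hstab : IsStable ({0}ᶜ : Set (E n)) p u) :
    ∀ᵐ x : E n, u x = 0 := by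
  have : NeZero n := ⟨by lia⟩
  have hp₁ : 1 < p := (one_lt_and_div_lt (by exact_mod_cast hn) hp).1
  have hk : 6 / (p - 1) * (p - 1) = 6 := div_mul_cancel₀ _ (sub_ne_zero.mpr hp₁.ne')
  have huloc := locallyIntegrableOn_of_abs_rpow (by linarith) hu huL
  obtain ⟨w, hw : IsHomogeneousAE volume _ w u⟩ := hhom
  obtain ⟨κ, hκ₀, hκ₁, hκ⟩ := exists_coeff_angularSymbol_le hn hp hpc
  have hw₁ := hw.integrable_angular huloc
  exact hw.ae_eq_zero (angular_ae_eq_zero hp₁ hκ₀ hκ₁ hκ hw₁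
    ((hw.abs_rpow (p + 1)).integrable_angular huL) (hsol.moment_eq hk hw huloc hw₁)
    (hstab.integral_le hk hw))

open Triharmonic in
theorem theorem4p1 (n : ℕ) (hn : 7 ≤ n) (p : ℝ)
    (hp : ((n : ℝ) + 6) / ((n : ℝ) - 6) < p)
    (hpc : (p : EReal) < josephLundgrenExponent n)
    (u : E n → ℝ)
    (huW : MemW2Loc ({0}ᶜ : Set (E n)) 3 u)
    (huL : LocallyIntegrableOn (fun x => |u x| ^ (p + 1)) ({0}ᶜ : Set (E n)) volume)
    (hhom : ∃ w : E n → ℝ, ∀ᵐ x : E n, u x = ‖x‖ ^ (-(6 / (p - 1))) * w (‖x‖⁻¹ • x))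
    (hsol : IsWeakSolution ({0}ᶜ : Set (E n)) p u)
    (hstab : IsStable ({0}ᶜ : Set (E n)) p u) :
    ∀ᵐ x : E n, u x = 0 := by
  have : NeZero n := ⟨by lia⟩
  have huloc := huW.1.locallyIntegrableOn isOpen_compl_singleton
  exact theorem4p1_general n hn p hp hpc u
    (by simpa only [restrict_compl_singleton] using huloc.aestronglyMeasurable) huL hhom
    (hsol.isDistributionalSolution isOpen_compl_singleton huloc) hstab
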